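/- Let $X$ be a complex manifold of (pure, finite) dimension $d$ (compactness is not needed), let $H=(\mathbb C^\times)^p$, let $\widehat H$ be the group of holomorphic characters $\chi\colon H\to\mathbb C^\times$, let $\mathrm{Pic}(X)$ be the group of isomorphism classes of holomorphic line bundles on $X$ under tensor product, and let $K_X=\bigwedge^d T^*X$ be the canonical bundle. For a holomorphic principal $H$-bundle $M\to X$ (with right action $M\times H\to M$), its character map is the homomorphism $\lambda_M\colon\widehat H\to\mathrm{Pic}(X)$, $\lambda_M(\chi)=[M\times_H\mathbb C_\chi]$, where $M\times_H\mathbb C_\chi=(M\times\mathbb C)/H$ for the action $h\cdot(m,c)=(mh^{-1},\chi(h)c)$. The bundle $M$ is called a CY bundle if there are a character $\chi\in\widehat H$ and a nowhere vanishing holomorphic form $\omega$ of top degree $d+p$ on $M$ such that $R_h^*\omega=\chi(h)\,\omega$ for all $h\in H$, where $R_h(m)=mh$. Theorem. Let $\lambda\colon\widehat H\to\mathrm{Pic}(X)$ be any group homomorphism whose image contains $[K_X]$. Then there exists a CY $H$-bundle $M$ over $X$ with $\lambda_M=\lambda$. It is unique up to isomorphism: every CY $H$-bundle $N$ over $X$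 with $\lambda_N=\lambda$ is isomorphic to $M$ as a holomorphic principal $H$-bundle over $X$, that is, there is an $H$-equivariant biholomorphic map $N\to M$ over $X$. -/

import Mathlib

open Bundle Set
open scoped TensorProduct Manifold ContDiff Topology

universe u

noncomputable section

namespace CYBundle

section LineBundles

/-- A holomorphic line bundle on the complex manifold `X` (modelled on `E`): a holomorphic vector
bundle with model fibre `ℂ`. -/
structure HolLineBundle (E X : Type u) [NormedAddCommGroup E] [NormedSpace ℂ E]
    [TopologicalSpace X] [ChartedSpace E X] where
  Fiber : X → Type u
  [addCommGroup : ∀ x, AddCommGroup (Fiber x)]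
  [module : ∀ x, Module ℂ (Fiber x)]
  [topologicalSpaceFiber : ∀ x, TopologicalSpace (Fiber x)]
  [topologicalSpaceTotal : TopologicalSpace (TotalSpace ℂ Fiber)]
  [fiberBundle : FiberBundle ℂ Fiber]
  [vectorBundle : VectorBundle ℂ ℂ Fiber]
  [holomorphic : ContMDiffVectorBundle ω ℂ Fiber 𝓘(ℂ, E)]

attribute [instance] HolLineBundle.addCommGroup HolLineBundle.module
  HolLineBundle.topologicalSpaceFiber HolLineBundle.topologicalSpaceTotal
  HolLineBundle.fiberBundle HolLineBundle.vectorBundle HolLineBundle.holomorphic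

variable {E X : Type u} [NormedAddCommGroup E] [NormedSpace ℂ E]
  [TopologicalSpace X] [ChartedSpace E X]

/-- Holomorphic isomorphism of line bundles over `X`: fibrewise linear isomorphisms such that the
induced bijection of total spaces is holomorphic in both directions. -/
def HolLineBundle.Isom (L L' : HolLineBundle E X) : Prop :=
  ∃ φ : ∀ x, L.Fiber x ≃ₗ[ℂ] L'.Fiber x,
    ContMDiff (𝓘(ℂ, E).prod 𝓘(ℂ, ℂ)) (𝓘(ℂ, E).prod 𝓘(ℂ, ℂ)) ω
      (fun v : TotalSpace ℂ L.Fiber => TotalSpace.mk' ℂ v.1 (φ v.1 v.2)) ∧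
    ContMDiff (𝓘(ℂ, E).prod 𝓘(ℂ, ℂ)) (𝓘(ℂ, E).prod 𝓘(ℂ, ℂ)) ω
      (fun v : TotalSpace ℂ L'.Fiber => TotalSpace.mk' ℂ v.1 ((φ v.1).symm v.2))

/-- A way of presenting a holomorphic line bundle: a family of complex vector spaces `L x` with
local frames `frame i` (and dual coordinates `coord i`) on open sets `U i ∋ i`, such that the
transition functions are holomorphic. -/
structure LineFrames (E : Type u) {X : Type u} [NormedAddCommGroup E] [NormedSpace ℂ E]
    [TopologicalSpace X] [ChartedSpace E X]
    (L : X → Type u) [∀ x, AddCommGroup (L x)] [∀ x, Module ℂ (L x)] where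
  U : X → Set X
  isOpen_U : ∀ i, IsOpen (U i)
  mem_U : ∀ i, i ∈ U i
  frame : ∀ _ : X, ∀ x, L x
  coord : ∀ _ : X, ∀ x, L x →ₗ[ℂ] ℂ
  coord_frame : ∀ i x, x ∈ U i → coord i x (frame i x) = 1
  coord_smul_frame : ∀ i x, x ∈ U i → ∀ v, coord i x v • frame i x = v
  holomorphic : ∀ i j, ContMDiffOn 𝓘(ℂ, E) 𝓘(ℂ, ℂ) ω (fun x => coord j x (frame i x)) (U i ∩ U j)

namespace LineFrames

variable {L : X → Type u} [∀ x, AddCommGroup (L x)] [∀ x, Module ℂ (L x)] (A : LineFrames E L)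

/-- The local trivialization given by a frame. -/
def pretriv (i : X) : Pretrivialization ℂ (π ℂ L) where
  toFun p := (p.1, A.coord i p.1 p.2)
  invFun q := ⟨q.1, q.2 • A.frame i q.1⟩
  source := (π ℂ L) ⁻¹' A.U i
  target := A.U i ×ˢ univ
  map_source' := fun _ h => ⟨h, mem_univ _⟩
  map_target' := fun _ h => h.1
  left_inv' := by
    rintro ⟨x, v⟩ h
    simp only [TotalSpace.mk_inj]
    exact A.coord_smul_frame i x h v
  right_inv' := by
    rintro ⟨x, c⟩ ⟨h, -⟩
    simp [A.coord_frame i x h]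
  open_target := (A.isOpen_U i).prod isOpen_univ
  baseSet := A.U i
  open_baseSet := A.isOpen_U i
  source_eq := rfl
  target_eq := rfl
  proj_toFun _ _ := rfl

theorem pretriv_symm {i x : X} (hx : x ∈ A.U i) (c : ℂ) :
    (A.pretriv i).symm x c = c • A.frame i x := by
  rw [Pretrivialization.symm_apply _ hx]
  rfl

theorem coord_pretriv_symm {i j x : X} (hx : x ∈ A.U i) (c : ℂ) :
    (A.pretriv j ⟨x, (A.pretriv i).symm x c⟩).2 = c * A.coord j x (A.frame i x) := by
  rw [A.pretriv_symm hx]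
  change A.coord j x (c • A.frame i x) = _
  simp

theorem contMDiffOn_change (i j : X) : ContMDiffOn 𝓘(ℂ, E) 𝓘(ℂ, ℂ →L[ℂ] ℂ) ω
    (fun x => A.coord j x (A.frame i x) • ContinuousLinearMap.id ℂ ℂ) (A.U i ∩ A.U j) :=
  (A.holomorphic i j).smul contMDiffOn_const

/-- The fibres are given the topology of `ℂ`, and the local trivializations are glued. -/
def prebundle : letI := fun x => TopologicalSpace.induced (A.coord x x) inferInstance
    VectorPrebundle ℂ ℂ L :=
  letI := fun x => TopologicalSpace.induced (A.coord x x) inferInstance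
  { pretrivializationAtlas := range A.pretriv
    pretrivialization_linear' := by
      rintro _ ⟨i, rfl⟩
      exact ⟨fun x _ => ⟨(A.coord i x).map_add, (A.coord i x).map_smul⟩⟩
    pretrivializationAt := A.pretriv
    mem_base_pretrivializationAt := A.mem_U
    pretrivialization_mem_atlas := fun i => ⟨i, rfl⟩
    exists_coordChange := by
      rintro _ ⟨i, rfl⟩ _ ⟨j, rfl⟩
      refine ⟨_, (A.contMDiffOn_change i j).continuousOn, fun x hx v => ?_⟩
      rw [A.coord_pretriv_symm hx.1]
      simp [mul_comm]
    totalSpaceMk_isInducing := fun x => by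
      change Topology.IsInducing (fun v => (x, A.coord x x v))
      rw [Topology.isInducing_const_prod]
      exact ⟨rfl⟩ }

/-- The holomorphic line bundle presented by local frames. -/
def toLineBundle : HolLineBundle E X :=
  letI := fun x => TopologicalSpace.induced (A.coord x x) inferInstance
  letI := A.prebundle.totalSpaceTopology
  letI := A.prebundle.toFiberBundle
  haveI := A.prebundle.toVectorBundle
  haveI : A.prebundle.IsContMDiff 𝓘(ℂ, E) ω :=
    ⟨by
      rintro _ ⟨i, rfl⟩ _ ⟨j, rfl⟩
      refine ⟨_, A.contMDiffOn_change i j, fun x hx v => ?_⟩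
      rw [A.coord_pretriv_symm hx.1]
      simp [mul_comm]⟩
  haveI := A.prebundle.contMDiffVectorBundle (n := ω) 𝓘(ℂ, E)
  { Fiber := L }

end LineFrames

namespace HolLineBundle

variable (L L' : HolLineBundle E X)

/-- The domain of the preferred trivialization of `L` near `i`. -/
def U (i : X) : Set X := (trivializationAt ℂ L.Fiber i).baseSet

/-- The local frame of `L` given by its preferred trivialization near `i`. -/
def frame (i x : X) : L.Fiber x := (trivializationAt ℂ L.Fiber i).symm x 1

/-- The coordinate on `L` given by its preferred trivialization near `i`. -/
def coord (i x : X) : L.Fiber x →ₗ[ℂ] ℂ := (trivializationAt ℂ L.Fiber i).linearMapAt ℂ x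

theorem coord_apply {i x : X} (hx : x ∈ L.U i) (v : L.Fiber x) :
    L.coord i x v = (trivializationAt ℂ L.Fiber i ⟨x, v⟩).2 := by
  rw [coord, Trivialization.coe_linearMapAt_of_mem _ hx]

/-- The local frames of a line bundle. -/
def frames : LineFrames E L.Fiber where
  U := L.U
  isOpen_U i := (trivializationAt ℂ L.Fiber i).open_baseSet
  mem_U i := mem_baseSet_trivializationAt ℂ L.Fiber i
  frame := L.frame
  coord := L.coord
  coord_frame i x hx := by
    rw [L.coord_apply hx, frame, Trivialization.apply_mk_symm _ hx]
  coord_smul_frame i x hx v := by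
    have h := (trivializationAt ℂ L.Fiber i).symmₗ_linearMapAt (R := ℂ) hx v
    rw [frame, coord, ← Trivialization.coe_symmₗ (R := ℂ) _ hx, ← map_smul]
    simpa using h
  holomorphic i j := by
    have h := contMDiffOn_coordChangeL (IB := 𝓘(ℂ, E)) (n := ω)
      (trivializationAt ℂ L.Fiber i) (trivializationAt ℂ L.Fiber j)
    refine (h.clm_apply (contMDiffOn_const (c := (1 : ℂ)))).congr fun x hx => ?_
    rw [L.coord_apply hx.2, ContinuousLinearEquiv.coe_coe, Trivialization.coordChangeL_apply _ _ hx]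
    rfl


theorem coord_frame {i x : X} (hx : x ∈ L.U i) : L.coord i x (L.frame i x) = 1 :=
  L.frames.coord_frame i x hx

theorem coord_smul_frame {i x : X} (hx : x ∈ L.U i) (v : L.Fiber x) :
    L.coord i x v • L.frame i x = v :=
  L.frames.coord_smul_frame i x hx v

theorem U_mem_nhds {i x : X} (hx : x ∈ L.U i) : L.U i ∈ 𝓝 x :=
  (L.frames.isOpen_U i).mem_nhds hx

theorem mem_U (i : X) : i ∈ L.U i := L.frames.mem_U i

variable {L L'}

theorem contMDiffAt_iff_coord {F M : Type*} [NormedAddCommGroup F] [NormedSpace ℂ F]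
    [TopologicalSpace M] [ChartedSpace F M] {f : M → TotalSpace ℂ L.Fiber} {m : M} {i : X}
    (hi : (f m).1 ∈ L.U i) (hf : ContMDiffAt 𝓘(ℂ, F) 𝓘(ℂ, E) ω (fun y => (f y).1) m) :
    ContMDiffAt 𝓘(ℂ, F) (𝓘(ℂ, E).prod 𝓘(ℂ, ℂ)) ω f m ↔
      ContMDiffAt 𝓘(ℂ, F) 𝓘(ℂ, ℂ) ω (fun y => L.coord i (f y).1 (f y).2) m := by
  rw [Trivialization.contMDiffAt_iff (e := trivializationAt ℂ L.Fiber i)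
    ((Trivialization.mem_source _).2 hi)]
  refine ⟨fun h => h.2.congr_of_eventuallyEq ?_, fun h => ⟨hf, h.congr_of_eventuallyEq ?_⟩⟩ <;>
  · filter_upwards [hf.continuousAt.preimage_mem_nhds (L.U_mem_nhds hi)] with y hy
    rw [L.coord_apply hy]

theorem contMDiff_of_frames (φ : ∀ x, L.Fiber x ≃ₗ[ℂ] L'.Fiber x) (c : X → X → ℂ)
    (hc : ∀ i, ContMDiffAt 𝓘(ℂ, E) 𝓘(ℂ, ℂ) ω (c i) i)
    (hφ : ∀ i x, x ∈ L.U i → x ∈ L'.U i → φ x (L.frame i x) = c i x • L'.frame i x) :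
    ContMDiff (𝓘(ℂ, E).prod 𝓘(ℂ, ℂ)) (𝓘(ℂ, E).prod 𝓘(ℂ, ℂ)) ω
      (fun v : TotalSpace ℂ L.Fiber => TotalSpace.mk' ℂ v.1 (φ v.1 v.2)) := by
  intro v
  rw [contMDiffAt_totalSpace]
  have hp := contMDiffAt_proj (IB := 𝓘(ℂ, E)) (n := ω) (𝕜 := ℂ) L.Fiber (p := v)
  refine ⟨hp, ?_⟩
  have h1 := (contMDiffAt_totalSpace.1 (contMDiffAt_id (I := 𝓘(ℂ, E).prod 𝓘(ℂ, ℂ)) (n := ω)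
    (x := v))).2
  have h2 := h1.mul ((hc v.1).comp v hp)
  refine h2.congr_of_eventuallyEq ?_
  filter_upwards [hp.continuousAt.preimage_mem_nhds (L.U_mem_nhds (L.mem_U v.1)),
    hp.continuousAt.preimage_mem_nhds (L'.U_mem_nhds (L'.mem_U v.1))] with w hw hw'
  have e1 := L.coord_apply hw w.2
  have e2 := L'.coord_apply hw' (φ w.1 w.2)
  change (trivializationAt ℂ L'.Fiber v.1 ⟨w.1, φ w.1 w.2⟩).2 = _
  rw [← e2]
  conv_lhs => rw [← L.coord_smul_frame hw w.2, map_smul, hφ _ _ hw hw', map_smul, map_smul,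
    L'.coord_frame hw']
  rw [e1]
  simp

/-- Line bundles with cohomologous transition functions are isomorphic. -/
theorem isom_of_cocycle (c : X → X → ℂ)
    (hc : ∀ i, ContMDiffAt 𝓘(ℂ, E) 𝓘(ℂ, ℂ) ω (c i) i)
    (h0 : ∀ i x, x ∈ L.U i → x ∈ L'.U i → c i x ≠ 0)
    (h : ∀ i j x, x ∈ L.U i → x ∈ L'.U i → x ∈ L.U j → x ∈ L'.U j →
      c i x * L'.coord j x (L'.frame i x) = L.coord j x (L.frame i x) * c j x) :
    L.Isom L' := by
  have n0 : ∀ x, c x x ≠ 0 := fun x => h0 x x (L.mem_U x) (L'.mem_U x)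
  let φ : ∀ x, L.Fiber x ≃ₗ[ℂ] L'.Fiber x := fun x =>
    LinearEquiv.ofLinearMap
      ((c x x • L.coord x x).smulRight (L'.frame x x))
      (((c x x)⁻¹ • L'.coord x x).smulRight (L.frame x x))
      (by
        ext v
        simp only [LinearMap.comp_apply, LinearMap.smulRight_apply, LinearMap.smul_apply, map_smul,
          L.coord_frame (L.mem_U x), smul_eq_mul, mul_one, LinearMap.id_apply]
        rw [smul_smul, mul_right_comm, inv_mul_cancel₀ (n0 x), one_mul,
          L'.coord_smul_frame (L'.mem_U x)])
      (by
        ext v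
        simp only [LinearMap.comp_apply, LinearMap.smulRight_apply, LinearMap.smul_apply, map_smul,
          L'.coord_frame (L'.mem_U x), smul_eq_mul, mul_one, LinearMap.id_apply]
        rw [smul_smul, mul_right_comm, mul_inv_cancel₀ (n0 x), one_mul,
          L.coord_smul_frame (L.mem_U x)])
  have hφ : ∀ i x, x ∈ L.U i → x ∈ L'.U i → φ x (L.frame i x) = c i x • L'.frame i x := by
    intro i x hi hi'
    change (c x x * L.coord x x (L.frame i x)) • L'.frame x x = _
    rw [mul_comm, ← h i x x hi hi' (L.mem_U x) (L'.mem_U x), mul_smul,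
      L'.coord_smul_frame (L'.mem_U x)]
  refine ⟨φ, contMDiff_of_frames φ c hc hφ, contMDiff_of_frames (fun x => (φ x).symm)
    (fun i x => (c i x)⁻¹) (fun i => (hc i).inv₀ (n0 i)) fun i x hi hi' => ?_⟩
  rw [LinearEquiv.symm_apply_eq, map_smul, hφ i x hi' hi, inv_smul_smul₀ (h0 i x hi' hi)]

/-- Isomorphic line bundles have cohomologous transition functions. -/
theorem Isom.exists_cocycle (hL : L.Isom L') : ∃ c : X → X → ℂ,
    (∀ i, ContMDiffAt 𝓘(ℂ, E) 𝓘(ℂ, ℂ) ω (c i) i) ∧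
    (∀ i x, x ∈ L.U i → x ∈ L'.U i → c i x ≠ 0) ∧
    (∀ i j x, x ∈ L.U i → x ∈ L'.U i → x ∈ L.U j → x ∈ L'.U j →
      c i x * L'.coord j x (L'.frame i x) = L.coord j x (L.frame i x) * c j x) := by
  obtain ⟨φ, hφ, -⟩ := hL
  have key : ∀ i x, x ∈ L'.U i →
      φ x (L.frame i x) = L'.coord i x (φ x (L.frame i x)) • L'.frame i x :=
    fun i x hx => (L'.coord_smul_frame hx _).symm
  refine ⟨fun i x => L'.coord i x (φ x (L.frame i x)), fun i => ?_, fun i x hi hi' h => ?_,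
    fun i j x hi hi' hj hj' => ?_⟩
  · have hs : ContMDiffAt 𝓘(ℂ, E) (𝓘(ℂ, E).prod 𝓘(ℂ, ℂ)) ω
        (fun x => TotalSpace.mk' ℂ x (L.frame i x)) i := by
      refine (contMDiffAt_iff_coord (L.mem_U i) contMDiffAt_id).2 ?_
      refine (contMDiffAt_const (c := (1 : ℂ))).congr_of_eventuallyEq ?_
      filter_upwards [L.U_mem_nhds (L.mem_U i)] with x hx using L.coord_frame hx
    exact (contMDiffAt_iff_coord (L'.mem_U i) contMDiffAt_id).1 (ContMDiffAt.comp i (hφ _) hs)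
  · have h1 := key i x hi'
    rw [show L'.coord i x (φ x (L.frame i x)) = 0 from h, zero_smul,
      LinearEquiv.map_eq_zero_iff] at h1
    have h2 := L.coord_frame hi
    rw [h1, map_zero] at h2
    exact zero_ne_one h2
  · dsimp only
    rw [← smul_eq_mul, ← map_smul, ← key i x hi', ← smul_eq_mul, ← map_smul, ← map_smul,
      L.coord_smul_frame hj]

end HolLineBundle

namespace LineFrames

variable {L : X → Type u} [∀ x, AddCommGroup (L x)] [∀ x, Module ℂ (L x)] (A : LineFrames E L)

theorem toLineBundle_U (i : X) : A.toLineBundle.U i = A.U i := rfl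

theorem toLineBundle_frame {i x : X} (hx : x ∈ A.U i) : A.toLineBundle.frame i x = A.frame i x :=
  (A.pretriv_symm hx 1).trans (one_smul _ _)

theorem toLineBundle_coord {i x : X} (hx : x ∈ A.U i) : A.toLineBundle.coord i x = A.coord i x := by
  ext v
  exact A.toLineBundle.coord_apply hx v

theorem toLineBundle_trans {i j x : X} (hi : x ∈ A.U i) (hj : x ∈ A.U j) :
    A.toLineBundle.coord j x (A.toLineBundle.frame i x) = A.coord j x (A.frame i x) := by
  rw [A.toLineBundle_frame hi, A.toLineBundle_coord hj]
  rfl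

end LineFrames

namespace HolLineBundle

variable (L L' : HolLineBundle E X)

/-- The tensor product of line bundles: fibres `L x ⊗ L' x`, local frames `s ⊗ s'`. -/
def tensor : HolLineBundle E X :=
  LineFrames.toLineBundle (E := E) (L := fun x => L.Fiber x ⊗[ℂ] L'.Fiber x)
  { U := fun i => L.U i ∩ L'.U i
    isOpen_U := fun i => (L.frames.isOpen_U i).inter (L'.frames.isOpen_U i)
    mem_U := fun i => ⟨L.mem_U i, L'.mem_U i⟩
    frame := fun i x => L.frame i x ⊗ₜ L'.frame i x
    coord := fun i x => LinearMap.mul' ℂ ℂ ∘ₗ TensorProduct.map (L.coord i x) (L'.coord i x)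
    coord_frame := fun i x hx => by simp [L.coord_frame hx.1, L'.coord_frame hx.2]
    coord_smul_frame := fun i x hx v => by
      induction v with
      | zero => simp
      | add v w hv hw => rw [map_add, add_smul, hv, hw]
      | tmul v w =>
        simp only [LinearMap.comp_apply, TensorProduct.map_tmul, LinearMap.mul'_apply]
        rw [← TensorProduct.smul_tmul_smul, L.coord_smul_frame hx.1, L'.coord_smul_frame hx.2]
    holomorphic := fun i j => by
      refine (((L.frames.holomorphic i j).mono ?_).mul
        ((L'.frames.holomorphic i j).mono ?_)).congr fun x _ => ?_
      · exact fun x hx => ⟨hx.1.1, hx.2.1⟩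
      · exact fun x hx => ⟨hx.1.2, hx.2.2⟩
      · simp [HolLineBundle.frames] }

/-- The dual line bundle. -/
def dual : HolLineBundle E X :=
  LineFrames.toLineBundle (E := E) (L := fun x => Module.Dual ℂ (L.Fiber x))
  { U := L.U
    isOpen_U := L.frames.isOpen_U
    mem_U := L.mem_U
    frame := fun i x => L.coord i x
    coord := fun i x => Module.Dual.eval ℂ (L.Fiber x) (L.frame i x)
    coord_frame := fun i x hx => by simp [L.coord_frame hx]
    coord_smul_frame := fun i x hx f => by
      ext v
      conv_rhs => rw [← L.coord_smul_frame hx v, map_smul]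
      simp [mul_comm]
    holomorphic := fun i j => by
      refine ((L.frames.holomorphic j i).mono ?_).congr fun x _ => ?_
      · exact fun x hx => ⟨hx.2, hx.1⟩
      · simp [HolLineBundle.frames] }

/-- The trivial line bundle `X × ℂ`. -/
def trivial (E X : Type u) [NormedAddCommGroup E] [NormedSpace ℂ E]
    [TopologicalSpace X] [ChartedSpace E X] : HolLineBundle E X :=
  LineFrames.toLineBundle (E := E) (L := fun _ : X => ULift.{u} ℂ)
  { U := fun _ => univ
    isOpen_U := fun _ => isOpen_univ
    mem_U := fun _ => mem_univ _
    frame := fun _ _ => ⟨1⟩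
    coord := fun _ _ => ULift.moduleEquiv.toLinearMap
    coord_frame := fun _ _ _ => rfl
    coord_smul_frame := fun _ _ _ v => by ext; simp
    holomorphic := fun _ _ => contMDiffOn_const }

theorem tensor_trans {i j x : X} (hi : x ∈ L.U i ∩ L'.U i) (hj : x ∈ L.U j ∩ L'.U j) :
    (L.tensor L').coord j x ((L.tensor L').frame i x) =
      L.coord j x (L.frame i x) * L'.coord j x (L'.frame i x) := by
  rw [tensor, LineFrames.toLineBundle_trans _ hi hj]
  simp

theorem dual_trans {i j x : X} (hi : x ∈ L.U i) (hj : x ∈ L.U j) :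
    L.dual.coord j x (L.dual.frame i x) = L.coord i x (L.frame j x) := by
  rw [dual, LineFrames.toLineBundle_trans _ hi hj]
  simp

theorem trivial_trans (i j x : X) :
    (trivial E X).coord j x ((trivial E X).frame i x) = 1 := by
  rw [trivial, LineFrames.toLineBundle_trans _ (mem_univ _) (mem_univ _)]
  rfl

theorem trans_mul_trans {i j x : X} (hi : x ∈ L.U i) (hj : x ∈ L.U j) :
    L.coord i x (L.frame j x) * L.coord j x (L.frame i x) = 1 := by
  rw [mul_comm, ← smul_eq_mul, ← map_smul, L.coord_smul_frame hj, L.coord_frame hi]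

variable {L L'}

theorem isom_of_trans_eq (h : ∀ i j x, x ∈ L.U i → x ∈ L'.U i → x ∈ L.U j → x ∈ L'.U j →
    L'.coord j x (L'.frame i x) = L.coord j x (L.frame i x)) : L.Isom L' :=
  isom_of_cocycle (fun _ _ => 1) (fun _ => contMDiffAt_const) (fun _ _ _ _ => one_ne_zero)
    fun i j x a b c d => by rw [one_mul, mul_one, h i j x a b c d]

theorem Isom.refl (L : HolLineBundle E X) : L.Isom L := isom_of_trans_eq fun _ _ _ _ _ _ _ => rfl

theorem Isom.symm (h : L.Isom L') : L'.Isom L := by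
  obtain ⟨φ, h1, h2⟩ := h
  exact ⟨fun x => (φ x).symm, h2, h1⟩

theorem Isom.trans {L'' : HolLineBundle E X} (h : L.Isom L') (h' : L'.Isom L'') : L.Isom L'' := by
  obtain ⟨φ, h1, h2⟩ := h
  obtain ⟨ψ, h3, h4⟩ := h'
  exact ⟨fun x => (φ x).trans (ψ x), h3.comp h1, h2.comp h4⟩

theorem Isom.tensor {K K' : HolLineBundle E X} (h : L.Isom L') (h' : K.Isom K') :
    (L.tensor K).Isom (L'.tensor K') := by
  obtain ⟨c, h1, h2, h3⟩ := h.exists_cocycle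
  obtain ⟨d, k1, k2, k3⟩ := h'.exists_cocycle
  refine isom_of_cocycle (fun i x => c i x * d i x) (fun i => (h1 i).mul (k1 i))
    (fun i x a b => mul_ne_zero (h2 i x a.1 b.1) (k2 i x a.2 b.2)) fun i j x p q r s => ?_
  rw [tensor_trans _ _ q s, tensor_trans _ _ p r]
  linear_combination (d i x * K'.coord j x (K'.frame i x)) * h3 i j x p.1 q.1 r.1 s.1 +
    (L.coord j x (L.frame i x) * c j x) * k3 i j x p.2 q.2 r.2 s.2

theorem Isom.dual (h : L.Isom L') : L.dual.Isom L'.dual := by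
  obtain ⟨c, h1, h2, h3⟩ := h.exists_cocycle
  refine isom_of_cocycle (fun i x => (c i x)⁻¹)
    (fun i => (h1 i).inv₀ (h2 i i (L.mem_U i) (L'.mem_U i)))
    (fun i x a b => inv_ne_zero (h2 i x a b)) fun i j x p q r s => ?_
  have e := h3 j i x r s p q
  have ni := h2 i x p q
  have nj := h2 j x r s
  rw [dual_trans L' q s, dual_trans L p r]
  field_simp
  linear_combination e

/-- Isomorphism of holomorphic line bundles as an equivalence relation. -/
instance setoid (E X : Type u) [NormedAddCommGroup E] [NormedSpace ℂ E]
    [TopologicalSpace X] [ChartedSpace E X] : Setoid (HolLineBundle E X) where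
  r := Isom
  iseqv := ⟨Isom.refl, Isom.symm, Isom.trans⟩

end HolLineBundle

/-- The Picard group: isomorphism classes of holomorphic line bundles on `X`, with the tensor
product as (multiplicatively written) group law. -/
def Pic (E X : Type u) [NormedAddCommGroup E] [NormedSpace ℂ E]
    [TopologicalSpace X] [ChartedSpace E X] : Type (u + 1) :=
  Quotient (HolLineBundle.setoid E X)

/-- The class of a line bundle in the Picard group. -/
def HolLineBundle.toPic (L : HolLineBundle E X) : Pic E X := Quotient.mk _ L

instance : CommGroup (Pic E X) where
  mul := Quotient.map₂ HolLineBundle.tensor fun _ _ h _ _ h' => h.tensor h'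
  one := (HolLineBundle.trivial E X).toPic
  inv := Quotient.map HolLineBundle.dual fun _ _ h => h.dual
  mul_assoc := by
    rintro ⟨L⟩ ⟨K⟩ ⟨N⟩
    refine Quotient.sound (HolLineBundle.isom_of_trans_eq fun i j x p q r s => ?_)
    rw [HolLineBundle.tensor_trans _ _ q s, HolLineBundle.tensor_trans _ _ p r,
      HolLineBundle.tensor_trans _ _ q.2 s.2, HolLineBundle.tensor_trans _ _ p.1 r.1, mul_assoc]
  one_mul := by
    rintro ⟨L⟩
    refine Quotient.sound (HolLineBundle.isom_of_trans_eq fun i j x p q r s => ?_)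
    rw [HolLineBundle.tensor_trans _ _ p r, HolLineBundle.trivial_trans, one_mul]
  mul_one := by
    rintro ⟨L⟩
    refine Quotient.sound (HolLineBundle.isom_of_trans_eq fun i j x p q r s => ?_)
    rw [HolLineBundle.tensor_trans _ _ p r, HolLineBundle.trivial_trans, mul_one]
  inv_mul_cancel := by
    rintro ⟨L⟩
    refine Quotient.sound (HolLineBundle.isom_of_trans_eq fun i j x p q r s => ?_)
    rw [HolLineBundle.tensor_trans _ _ p r, HolLineBundle.trivial_trans,
      HolLineBundle.dual_trans L p.1 r.1, HolLineBundle.trans_mul_trans _ p.2 r.2]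
  mul_comm := by
    rintro ⟨L⟩ ⟨K⟩
    refine Quotient.sound (HolLineBundle.isom_of_trans_eq fun i j x p q r s => ?_)
    rw [HolLineBundle.tensor_trans _ _ p r, HolLineBundle.tensor_trans _ _ q s, mul_comm]

end LineBundles

section Canonical

open Module

variable (V Y : Type u) [NormedAddCommGroup V] [NormedSpace ℂ V] [FiniteDimensional ℂ V]
  [TopologicalSpace Y] [ChartedSpace V Y] [IsManifold 𝓘(ℂ, V) ω Y]

/-- The space `⋀ᵈ T*_y Y`, `d = dim Y`, of top degree complex linear forms at `y`. -/
abbrev TopForms (y : Y) : Type u := TangentSpace 𝓘(ℂ, V) y [⋀^Fin (finrank ℂ V)]→ₗ[ℂ] ℂ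

theorem contDiff_det : ContDiff ℂ ω (fun v : Fin (finrank ℂ V) → V => (finBasis ℂ V).det v) := by
  simp only [Basis.det_apply, Matrix.det_apply, Basis.toMatrix_apply]
  refine ContDiff.sum fun σ _ => ContDiff.const_smul _ (contDiff_prod fun k _ => ?_)
  exact (LinearMap.toContinuousLinearMap ((finBasis ℂ V).coord (σ k))).contDiff.comp
    (contDiff_apply ℂ V k)

/-- The canonical bundle `K_Y` of the complex manifold `Y`: fibres `TopForms V Y y`, local frames
`dw₁ ∧ ⋯ ∧ dw_d` for the charts `w` of `Y`. -/
def canonicalBundle : HolLineBundle V Y :=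
  LineFrames.toLineBundle (E := V) (L := TopForms V Y)
  { U := fun i => (trivializationAt V (TangentSpace 𝓘(ℂ, V)) i).baseSet
    isOpen_U := fun i => (trivializationAt V (TangentSpace 𝓘(ℂ, V)) i).open_baseSet
    mem_U := fun i => mem_baseSet_trivializationAt V (TangentSpace 𝓘(ℂ, V)) i
    frame := fun i y => (finBasis ℂ V).det.compLinearMap
      ((trivializationAt V (TangentSpace 𝓘(ℂ, V)) i).linearMapAt ℂ y)
    coord := fun i y =>
      { toFun := fun η => η fun k =>
          (trivializationAt V (TangentSpace 𝓘(ℂ, V)) i).symmₗ ℂ y (finBasis ℂ V k)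
        map_add' := fun _ _ => rfl
        map_smul' := fun _ _ => rfl }
    coord_frame := fun i y hy => by
      simp only [LinearMap.coe_mk, AddHom.coe_mk, AlternatingMap.compLinearMap_apply,
        Trivialization.linearMapAt_symmₗ _ hy, Basis.det_self]
    coord_smul_frame := fun i y hy η => by
      have h : η.compLinearMap ((trivializationAt V (TangentSpace 𝓘(ℂ, V)) i).symmₗ ℂ y) = _ :=
        AlternatingMap.eq_smul_basis_det (finBasis ℂ V) _
      ext v
      have h' := congrArg (fun f => f fun k =>
        (trivializationAt V (TangentSpace 𝓘(ℂ, V)) i).linearMapAt ℂ y (v k)) h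
      simp only [AlternatingMap.compLinearMap_apply, Trivialization.symmₗ_linearMapAt _ hy] at h'
      rw [h']
      rfl
    holomorphic := fun i j => by
      have h := contMDiffOn_coordChangeL (IB := 𝓘(ℂ, V)) (n := ω)
        (trivializationAt V (TangentSpace 𝓘(ℂ, V)) j)
        (trivializationAt V (TangentSpace 𝓘(ℂ, V)) i)
      have h2 : ContMDiffOn 𝓘(ℂ, V) 𝓘(ℂ, Fin (finrank ℂ V) → V) ω
          (fun (y : Y) k => (trivializationAt V (TangentSpace 𝓘(ℂ, V)) j).coordChangeL ℂ
            (trivializationAt V (TangentSpace 𝓘(ℂ, V)) i) y (finBasis ℂ V k))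
          ((trivializationAt V (TangentSpace 𝓘(ℂ, V)) j).baseSet ∩
            (trivializationAt V (TangentSpace 𝓘(ℂ, V)) i).baseSet) := by
        rw [contMDiffOn_pi_space]
        exact fun k => h.clm_apply contMDiffOn_const
      have h3 := (contDiff_det V).contMDiff.comp_contMDiffOn h2
      refine (h3.mono fun y hy => ⟨hy.2, hy.1⟩).congr fun y hy => ?_
      simp only [LinearMap.coe_mk, AddHom.coe_mk, AlternatingMap.compLinearMap_apply,
        Function.comp_apply]
      congr 1
      ext1 k
      rw [Trivialization.coordChangeL_apply _ _ ⟨hy.2, hy.1⟩,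
        Trivialization.coe_linearMapAt_of_mem _ hy.1, Trivialization.coe_symmₗ _ hy.2] }

end Canonical

section Torus

/-- The complex torus `(ℂˣ)ᵖ`. -/
def Torus (p : ℕ) : Type := Fin p → ℂˣ

instance (p : ℕ) : CommGroup (Torus p) := inferInstanceAs (CommGroup (Fin p → ℂˣ))

instance (p : ℕ) : TopologicalSpace (Torus p) := inferInstanceAs (TopologicalSpace (Fin p → ℂˣ))

theorem Torus.isOpenEmbedding (p : ℕ) :
    Topology.IsOpenEmbedding (fun (h : Torus p) (k : Fin p) => ((h k : ℂˣ) : ℂ)) :=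
  Topology.IsOpenEmbedding.piMap fun _ => Units.isOpenEmbedding_val

/-- `(ℂˣ)ᵖ` is a complex manifold as an open subset of `ℂᵖ`. -/
instance (p : ℕ) : ChartedSpace (Fin p → ℂ) (Torus p) :=
  (Torus.isOpenEmbedding p).singletonChartedSpace

instance (p : ℕ) : IsManifold 𝓘(ℂ, Fin p → ℂ) ω (Torus p) :=
  (Torus.isOpenEmbedding p).isManifold_singleton

/-- The group of holomorphic characters `(ℂˣ)ᵖ → ℂˣ`. -/
def CharGroup (p : ℕ) : Subgroup (Torus p →* ℂˣ) where
  carrier := {χ | ContMDiff 𝓘(ℂ, Fin p → ℂ) 𝓘(ℂ, ℂ) ω χ}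
  mul_mem' := fun ha hb => ContMDiff.mul (I := 𝓘(ℂ, ℂ)) ha hb
  one_mem' := contMDiff_const
  inv_mem' := fun ha => ContMDiff.inv (I := 𝓘(ℂ, ℂ)) ha

end Torus

section PrincipalBundles

/-- A holomorphic principal `(ℂˣ)ᵖ`-bundle on the complex manifold `X`: a complex manifold `M` with
a right action of `(ℂˣ)ᵖ` (as the group is commutative, it is recorded as a `MulAction`:
`h • m` is `m h`) and a projection to `X` which is locally, equivariantly and biholomorphically
`U × (ℂˣ)ᵖ → U`, where `(ℂˣ)ᵖ` acts on itself by multiplication. (So the action is holomorphic, and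
free and transitive on the fibres; `M` is Hausdorff or second countable if `X` is.) -/
structure PrincipalBundle (p : ℕ) (E X : Type u) [NormedAddCommGroup E] [NormedSpace ℂ E]
    [TopologicalSpace X] [ChartedSpace E X] where
  M : Type u
  [topologicalSpace : TopologicalSpace M]
  [chartedSpace : ChartedSpace (E × (Fin p → ℂ)) M]
  [isManifold : IsManifold 𝓘(ℂ, E × (Fin p → ℂ)) ω M]
  [mulAction : MulAction (Torus p) M]
  proj : M → X
  proj_smul : ∀ (h : Torus p) (m : M), proj (h • m) = proj m
  exists_trivialization : ∀ x : X, ∃ e : Trivialization (Torus p) proj, x ∈ e.baseSet ∧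
    ContMDiffOn 𝓘(ℂ, E × (Fin p → ℂ)) (𝓘(ℂ, E).prod 𝓘(ℂ, Fin p → ℂ)) ω e e.source ∧
    ContMDiffOn (𝓘(ℂ, E).prod 𝓘(ℂ, Fin p → ℂ)) 𝓘(ℂ, E × (Fin p → ℂ)) ω
      e.toOpenPartialHomeomorph.symm e.target ∧
    ∀ (h : Torus p) (m : M), proj m ∈ e.baseSet → e (h • m) = (proj m, h * (e m).2)

attribute [instance] PrincipalBundle.topologicalSpace PrincipalBundle.chartedSpace
  PrincipalBundle.isManifold PrincipalBundle.mulAction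

namespace PrincipalBundle

variable {p : ℕ} {E X : Type u} [NormedAddCommGroup E] [NormedSpace ℂ E]
  [TopologicalSpace X] [ChartedSpace E X]

/-- Isomorphism of principal bundles: an equivariant biholomorphic map over `X`. -/
def Isom (P Q : PrincipalBundle p E X) : Prop :=
  ∃ Φ : Diffeomorph 𝓘(ℂ, E × (Fin p → ℂ)) 𝓘(ℂ, E × (Fin p → ℂ)) P.M Q.M ω,
    (∀ m, Q.proj (Φ m) = P.proj m) ∧ ∀ (h : Torus p) (m : P.M), Φ (h • m) = h • Φ m

variable (P : PrincipalBundle p E X)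

/-- A chosen equivariant local trivialization near `i`. -/
def triv (i : X) : Trivialization (Torus p) P.proj := (P.exists_trivialization i).choose

theorem mem_triv (i : X) : i ∈ (P.triv i).baseSet := (P.exists_trivialization i).choose_spec.1

theorem triv_smul {i : X} (h : Torus p) {m : P.M} (hm : P.proj m ∈ (P.triv i).baseSet) :
    (P.triv i (h • m)).2 = h * (P.triv i m).2 := by
  exact congrArg Prod.snd ((P.exists_trivialization i).choose_spec.2.2.2 h m hm)

/-- The local section of `P` given by the chosen trivialization near `i`. -/
def sec (i x : X) : P.M := (P.triv i).toOpenPartialHomeomorph.symm (x, 1)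

theorem proj_sec {i x : X} (hx : x ∈ (P.triv i).baseSet) : P.proj (P.sec i x) = x :=
  (P.triv i).proj_symm_apply' hx

theorem triv_sec {i x : X} (hx : x ∈ (P.triv i).baseSet) : P.triv i (P.sec i x) = (x, 1) :=
  (P.triv i).apply_symm_apply' hx

/-- The action is transitive on the fibres. -/
theorem exists_smul_eq {m m' : P.M} (h : P.proj m = P.proj m') : ∃ k : Torus p, k • m = m' := by
  have hm := P.mem_triv (P.proj m)
  refine ⟨(P.triv (P.proj m) m').2 * ((P.triv (P.proj m) m).2)⁻¹, ?_⟩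
  refine (P.triv (P.proj m)).injOn ?_ ?_ (Prod.ext ?_ ?_)
  · rw [Trivialization.mem_source, P.proj_smul]; exact hm
  · rw [Trivialization.mem_source, ← h]; exact hm
  · rw [Trivialization.coe_coe, Trivialization.coe_fst' _ (by rw [P.proj_smul]; exact hm),
      Trivialization.coe_fst' _ (by rw [← h]; exact hm), P.proj_smul, h]
  · rw [Trivialization.coe_coe, P.triv_smul _ hm, inv_mul_cancel_right]

/-- The action is free. -/
theorem eq_one_of_smul_eq {h : Torus p} {m : P.M} (hm : h • m = m) : h = 1 := by
  have h1 := P.triv_smul h (P.mem_triv (P.proj m))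
  rw [hm] at h1
  exact right_eq_mul.1 h1

section Associated

variable (χ : CharGroup p)

/-- `(m, c) ∼ (m h⁻¹, χ(h) c)` on `M_x × ℂ`, where `M_x` is the fibre of `M` over `x`. -/
def assocSetoid (x : X) : Setoid ({m : P.M // P.proj m = x} × ℂ) where
  r a b := ∃ h : Torus p, b.1.1 = h⁻¹ • a.1.1 ∧ b.2 = (χ.1 h : ℂ) * a.2
  iseqv :=
    { refl := fun a => ⟨1, by simp, by simp⟩
      symm := by
        rintro a b ⟨h, h1, h2⟩
        exact ⟨h⁻¹, by rw [h1, inv_inv, smul_inv_smul], by rw [h2, map_inv, Units.inv_mul_cancel_left]⟩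
      trans := by
        rintro a b c ⟨h, h1, h2⟩ ⟨k, k1, k2⟩
        exact ⟨k * h, by rw [k1, h1, smul_smul, mul_inv], by
          rw [k2, h2, map_mul, Units.val_mul, mul_assoc]⟩ }

/-- The fibre over `x` of the associated line bundle `L_χ = M ×_H ℂ_χ = (M × ℂ_χ) / H`. -/
def AssocFiber (x : X) : Type u := Quotient (P.assocSetoid χ x)

/-- The class `[m, c]` in `L_χ`. -/
def assocMk {x : X} (m : {m : P.M // P.proj m = x}) (c : ℂ) : P.AssocFiber χ x :=
  Quotient.mk _ (m, c)

theorem assocMk_smul {x : X} (m m' : {m : P.M // P.proj m = x}) (h : Torus p)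
    (hm : m'.1 = h • m.1) (c : ℂ) : P.assocMk χ m' c = P.assocMk χ m ((χ.1 h : ℂ) * c) :=
  Quotient.sound ⟨h, by rw [hm, inv_smul_smul], rfl⟩

/-- A point of the fibre of `M` over `x`. -/
def base (x : X) : {m : P.M // P.proj m = x} := ⟨P.sec x x, P.proj_sec (P.mem_triv x)⟩

theorem assocMk_bijective {x : X} (m : {m : P.M // P.proj m = x}) :
    Function.Bijective (P.assocMk χ m) := by
  constructor
  · intro c c' h
    obtain ⟨k, h1, h2⟩ := Quotient.exact h
    have hk := P.eq_one_of_smul_eq h1.symm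
    rw [inv_eq_one] at hk
    subst hk
    simpa using h2.symm
  · rintro ⟨m', c⟩
    obtain ⟨k, hk⟩ := P.exists_smul_eq (m.2.trans m'.2.symm)
    exact ⟨_, (P.assocMk_smul χ m m' k hk.symm c).symm⟩

/-- The bijection `c ↦ [m, c]` for the chosen point `m` of the fibre of `M` over `x`. -/
def assocEquiv (x : X) : P.AssocFiber χ x ≃ ℂ :=
  (Equiv.ofBijective _ (P.assocMk_bijective χ (P.base x))).symm

/-- The vector space structure on the fibre is transported along `c ↦ [m, c]`; it does not depend
on `m`, see `assocMk_add` and `assocMk_smul_right`. -/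
instance (x : X) : AddCommGroup (P.AssocFiber χ x) := (P.assocEquiv χ x).addCommGroup

instance (x : X) : Module ℂ (P.AssocFiber χ x) := (P.assocEquiv χ x).module ℂ

theorem assocMk_eq {x : X} (m : {m : P.M // P.proj m = x}) :
    ∃ u : ℂ, ∀ c, P.assocMk χ m c = (P.assocEquiv χ x).symm (u * c) := by
  obtain ⟨k, hk⟩ := P.exists_smul_eq ((P.base x).2.trans m.2.symm)
  exact ⟨_, fun c => P.assocMk_smul χ (P.base x) m k hk.symm c⟩

theorem assocMk_add {x : X} (m : {m : P.M // P.proj m = x}) (a b : ℂ) :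
    P.assocMk χ m (a + b) = P.assocMk χ m a + P.assocMk χ m b := by
  obtain ⟨u, hu⟩ := P.assocMk_eq χ m
  simp only [hu, mul_add, Equiv.add_def, Equiv.apply_symm_apply]

theorem assocMk_smul_right {x : X} (m : {m : P.M // P.proj m = x}) (a b : ℂ) :
    P.assocMk χ m (a * b) = a • P.assocMk χ m b := by
  obtain ⟨u, hu⟩ := P.assocMk_eq χ m
  simp only [hu, Equiv.smul_def, Equiv.apply_symm_apply, smul_eq_mul, mul_left_comm]

/-- The coordinate `[m, c] ↦ χ(h) c`, where `m = s h` for the local section `s` near `i`. -/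
def assocCoord (i x : X) (hx : x ∈ (P.triv i).baseSet) : P.AssocFiber χ x →ₗ[ℂ] ℂ where
  toFun := Quotient.lift (fun a => (χ.1 (P.triv i a.1.1).2 : ℂ) * a.2) (by
    rintro ⟨⟨m, rfl⟩, c⟩ ⟨⟨m', hm'⟩, c'⟩ ⟨h, h1, h2⟩
    dsimp only at h1 h2 ⊢
    rw [h1, h2, P.triv_smul _ hx, map_mul, map_inv, Units.val_mul]
    linear_combination (-(χ.1 (P.triv i m).2 : ℂ) * c) * Units.inv_mul (χ.1 h))
  map_add' a b := by
    obtain ⟨c, rfl⟩ := (P.assocMk_bijective χ (P.base x)).2 a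
    obtain ⟨d, rfl⟩ := (P.assocMk_bijective χ (P.base x)).2 b
    rw [← assocMk_add]
    exact mul_add _ _ _
  map_smul' z a := by
    obtain ⟨c, rfl⟩ := (P.assocMk_bijective χ (P.base x)).2 a
    rw [← assocMk_smul_right]
    exact mul_left_comm _ _ _

open Classical in
/-- The local frame `x ↦ [s(x), 1]` of `L_χ`, for the local section `s` near `i`. -/
def assocFrame (i x : X) : P.AssocFiber χ x :=
  if hx : x ∈ (P.triv i).baseSet then P.assocMk χ ⟨P.sec i x, P.proj_sec hx⟩ 1 else 0

theorem assocCoord_frame {i j x : X} (hi : x ∈ (P.triv i).baseSet) (hj : x ∈ (P.triv j).baseSet) :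
    P.assocCoord χ j x hj (P.assocFrame χ i x) = (χ.1 (P.triv j (P.sec i x)).2 : ℂ) := by
  rw [assocFrame, dif_pos hi]
  exact mul_one _

open Classical in
/-- The associated line bundle `L_χ = M ×_H ℂ_χ`. -/
def assoc : HolLineBundle E X :=
  LineFrames.toLineBundle (E := E) (L := P.AssocFiber χ)
  { U := fun i => (P.triv i).baseSet
    isOpen_U := fun i => (P.triv i).open_baseSet
    mem_U := P.mem_triv
    frame := P.assocFrame χ
    coord := fun i x => if hx : x ∈ (P.triv i).baseSet then P.assocCoord χ i x hx else 0
    coord_frame := fun i x hx => by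
      rw [dif_pos hx, P.assocCoord_frame χ hx hx, P.triv_sec hx, map_one, Units.val_one]
    coord_smul_frame := fun i x hx v => by
      rw [dif_pos hx, assocFrame, dif_pos hx, ← assocMk_smul_right, mul_one]
      obtain ⟨c, rfl⟩ := (P.assocMk_bijective χ ⟨P.sec i x, P.proj_sec hx⟩).2 v
      congr 1
      change (χ.1 (P.triv i (P.sec i x)).2 : ℂ) * c = c
      rw [P.triv_sec hx, map_one, Units.val_one, one_mul]
    holomorphic := fun i j => by
      have hi := (P.exists_trivialization i).choose_spec.2.2.1
      have hj := (P.exists_trivialization j).choose_spec.2.1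
      have h1 : ContMDiffOn 𝓘(ℂ, E) (𝓘(ℂ, E).prod 𝓘(ℂ, Fin p → ℂ)) ω
          (fun x : X => (x, (1 : Torus p))) ((P.triv i).baseSet ∩ (P.triv j).baseSet) :=
        contMDiffOn_id.prodMk contMDiffOn_const
      have h2 := hi.comp h1 fun x hx => (P.triv i).mem_target.2 hx.1
      have h3 := hj.comp h2 fun x hx => (P.triv j).mem_source.2 (by
        change P.proj (P.sec i x) ∈ _
        rw [P.proj_sec hx.1]
        exact hx.2)
      have h4 : ContMDiff 𝓘(ℂ, Fin p → ℂ) 𝓘(ℂ, ℂ) ω (fun h : Torus p => (χ.1 h : ℂ)) :=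
        Units.contMDiff_val.comp χ.2
      refine (h4.comp_contMDiffOn (contMDiff_snd.comp_contMDiffOn h3)).congr fun x hx => ?_
      rw [dif_pos hx.2, P.assocCoord_frame χ hx.1 hx.2]
      rfl }

theorem assoc_trans {i j x : X} (hi : x ∈ (P.triv i).baseSet) (hj : x ∈ (P.triv j).baseSet) :
    (P.assoc χ).coord j x ((P.assoc χ).frame i x) = (χ.1 (P.triv j (P.sec i x)).2 : ℂ) := by
  rw [assoc, LineFrames.toLineBundle_trans _ hi hj]
  dsimp only
  rw [dif_pos hj, P.assocCoord_frame χ hi hj]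

end Associated

/-- The character map `λ_M : χ ↦ [L_χ] ∈ Pic X` of the principal bundle. -/
def charMap : CharGroup p →* Pic E X :=
  MonoidHom.mk' (fun χ => (P.assoc χ).toPic) fun χ ψ => by
    refine Quotient.sound (HolLineBundle.isom_of_trans_eq fun i j x hi _ hj _ => ?_)
    have hi' : x ∈ (P.triv i).baseSet := hi
    have hj' : x ∈ (P.triv j).baseSet := hj
    rw [HolLineBundle.tensor_trans _ _ ⟨hi', hi'⟩ ⟨hj', hj'⟩, assoc_trans _ _ hi' hj',
      assoc_trans _ _ hi' hj', assoc_trans _ _ hi' hj', Subgroup.coe_mul, MonoidHom.mul_apply,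
      Units.val_mul]

variable [FiniteDimensional ℂ E]

/-- `(ℂ η, χ)` is a CY structure on `M`: `η` is a nowhere vanishing holomorphic top form on `M` with
`Γ_h η = χ(h) η`, i.e. with `R_h^* η = χ(h) η` for the right translation `R_h : m ↦ m h`. -/
structure IsCYStructure (η : ∀ m : P.M, TopForms (E × (Fin p → ℂ)) P.M m) (χ : CharGroup p) :
    Prop where
  holomorphic : ContMDiff 𝓘(ℂ, E × (Fin p → ℂ)) (𝓘(ℂ, E × (Fin p → ℂ)).prod 𝓘(ℂ, ℂ)) ω
    (fun m : P.M =>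
      (⟨m, η m⟩ : TotalSpace ℂ (canonicalBundle (E × (Fin p → ℂ)) P.M).Fiber))
  ne_zero : ∀ m, η m ≠ 0
  equivariant : ∀ (h : Torus p) (m : P.M),
    (η (h • m)).compLinearMap
      (mfderiv 𝓘(ℂ, E × (Fin p → ℂ)) 𝓘(ℂ, E × (Fin p → ℂ)) (fun m' : P.M => h • m') m).toLinearMap
      = (χ.1 h : ℂ) • η m

/-- A principal bundle is a CY bundle if it admits a CY structure. -/
def IsCY : Prop := ∃ η χ, P.IsCYStructure η χ

end PrincipalBundle

end PrincipalBundles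

end CYBundle

end

open CYBundle

/-! Restricted to one factor `ℂˣ` and pulled back along `exp`, a holomorphic character becomes an
entire homomorphism `ℂ → ℂˣ` of period `2πi`, hence a power of `exp`. The characters of `(ℂˣ)ᵖ` are
therefore the monomials in the coordinate characters, and a homomorphism out of the character group
is determined by `p` line bundle classes (`charGroup_hom_ext`).

A principal bundle with transition functions `T i j` has associated bundles `L_χ` with transition
functions `χ (T i j)`. For the coordinate characters these are the components of `T`, so a
`(ℂˣ)ᵖ`-cocycle is the same thing as `p` cocycles of line bundles. Gluing representatives of the
classes `λ(coordChar k)` gives a bundle with character map `λ`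
(`PrincipalBundle.exists_charMap_eq`). Conversely, isomorphisms between the line bundles of two
principal bundles are `p` scalar coboundaries, which together form one torus-valued coboundary
(`isom_of_charMap_eq`).

For the form, suppose `λ(χ) = [K_X]` and let `φ : L_χ ≅ K_X`. On `M` the tautological section `m ↦
[m, 1]` trivializes the pullback of `L_χ` and has weight `χ` under translation, while the invariant
form `dt₁/t₁ ∧ ⋯ ∧ dt_p/t_p` trivializes the vertical directions. The CY form is `φ[m, 1] ∧ dt₁/t₁ ∧
⋯ ∧ dt_p/t_p`. In the coordinates `(z, t)` of a chart and a trivialization it is `c(z) χ(t) (∏ tₖ)⁻¹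
dz ∧ dt`, where `c` is `φ` read in the local frames. That these expressions agree on overlaps is the
block triangular Jacobian computation `coordForm_trans`; the result is `isCY_of_assoc_isom`. -/

noncomputable section

namespace CYBundle

/-! ### Holomorphic maps into the torus and its characters -/

section TorusCalculus

variable {p : ℕ} {F N : Type*} [NormedAddCommGroup F] [NormedSpace ℂ F] {H : Type*}
  [TopologicalSpace H] {I : ModelWithCorners ℂ F H} [TopologicalSpace N] [ChartedSpace H N]

/-- The standard embedding of the torus `(ℂˣ)ᵖ` into `ℂᵖ`. -/
def Torus.val (h : Torus p) : Fin p → ℂ := fun k => ((h k : ℂˣ) : ℂ)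

/-- The torus has a single chart, its open embedding into `ℂᵖ`. Reading `f` in that chart is
composing with `Torus.val`, and continuity transfers because the embedding is inducing. -/
theorem Torus.contMDiffAt_iff {f : N → Torus p} {x : N} :
    ContMDiffAt I 𝓘(ℂ, Fin p → ℂ) ω f x ↔
      ContMDiffAt I 𝓘(ℂ, Fin p → ℂ) ω (fun y => (f y).val) x := by
  rw [contMDiffAt_iff_target]
  refine ⟨fun h => h.2, fun h => ⟨?_, h⟩⟩
  exact (Torus.isOpenEmbedding p).isInducing.continuousAt_iff.2 h.continuousAt

theorem Torus.contMDiffAt_iff_apply {f : N → Torus p} {x : N} :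
    ContMDiffAt I 𝓘(ℂ, Fin p → ℂ) ω f x ↔
      ∀ k, ContMDiffAt I 𝓘(ℂ, ℂ) ω (fun y => ((f y k : ℂˣ) : ℂ)) x := by
  rw [Torus.contMDiffAt_iff, contMDiffAt_pi_space]
  rfl

theorem contMDiffAt_units_iff {f : N → ℂˣ} {x : N} :
    ContMDiffAt I 𝓘(ℂ, ℂ) ω f x ↔ ContMDiffAt I 𝓘(ℂ, ℂ) ω (fun y => (f y : ℂ)) x := by
  rw [contMDiffAt_iff_target]
  refine ⟨fun h => h.2, fun h => ⟨?_, h⟩⟩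
  exact Units.isOpenEmbedding_val.isInducing.continuousAt_iff.2 h.continuousAt

theorem Torus.contMDiffAt_mul {f g : N → Torus p} {x : N}
    (hf : ContMDiffAt I 𝓘(ℂ, Fin p → ℂ) ω f x) (hg : ContMDiffAt I 𝓘(ℂ, Fin p → ℂ) ω g x) :
    ContMDiffAt I 𝓘(ℂ, Fin p → ℂ) ω (fun y => f y * g y) x := by
  rw [Torus.contMDiffAt_iff_apply] at *
  exact fun k => (hf k).mul (hg k)

theorem Torus.contMDiffAt_inv {f : N → Torus p} {x : N}
    (hf : ContMDiffAt I 𝓘(ℂ, Fin p → ℂ) ω f x) :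
    ContMDiffAt I 𝓘(ℂ, Fin p → ℂ) ω (fun y => (f y)⁻¹) x := by
  rw [Torus.contMDiffAt_iff_apply] at *
  intro k
  refine ((hf k).inv₀ (Units.ne_zero _)).congr_of_eventuallyEq (Filter.Eventually.of_forall ?_)
  exact fun y => Units.val_inv_eq_inv_val _

theorem contMDiff_char (χ : CharGroup p) :
    ContMDiff 𝓘(ℂ, Fin p → ℂ) 𝓘(ℂ, ℂ) ω (fun h : Torus p => (χ.1 h : ℂ)) :=
  fun h => contMDiffAt_units_iff.1 (χ.2 h)

/-- The `k`-th coordinate character of `(ℂˣ)ᵖ`. -/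
def coordChar (k : Fin p) : CharGroup p :=
  ⟨Pi.evalMonoidHom (fun _ : Fin p => ℂˣ) k, fun _ =>
    contMDiffAt_units_iff.2 (Torus.contMDiffAt_iff_apply.1 contMDiffAt_id k)⟩

theorem coordChar_apply (k : Fin p) (h : Torus p) : (coordChar k).1 h = h k := rfl

/-- An entire function `f ≠ 0` with `f (z + w) = f z * f w` and period `2πi` is an integral power of `exp`. -/
theorem exists_int_of_exp_hom {f : ℂ → ℂ} (hf : Differentiable ℂ f)
    (hadd : ∀ z w, f (z + w) = f z * f w) (h0 : f 0 = 1) (hp : f (2 * Real.pi * Complex.I) = 1) :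
    ∃ n : ℤ, ∀ z, f z = Complex.exp z ^ n := by
  -- The equation `f w = f (w - z) * f z`, differentiated in `w` at `z`, gives the differential
  -- equation `f' = f'(0) f`.
  have hd : ∀ z, HasDerivAt f (deriv f 0 * f z) z := by
    intro z
    have h1 : HasDerivAt f (deriv f 0) (z - z) := by
      rw [sub_self]; exact (hf 0).hasDerivAt
    have h2 := (h1.comp_sub_const z z).mul_const (f z)
    refine h2.congr_of_eventuallyEq (Filter.Eventually.of_forall fun w => ?_)
    change f w = f (w - z) * f z
    rw [← hadd, sub_add_cancel]
  set a := deriv f 0 with ha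
  have hconst : ∀ z, f z * Complex.exp (-(a * z)) = 1 := by
    have hg : ∀ z, HasDerivAt (fun z => f z * Complex.exp (-(a * z))) 0 z := by
      intro z
      have h1 := (hd z).mul (((hasDerivAt_id z).const_mul a).neg.cexp)
      refine h1.congr_deriv ?_
      simp only [Pi.neg_apply, id]
      ring
    intro z
    have := is_const_of_deriv_eq_zero (fun z => (hg z).differentiableAt) (fun z => (hg z).deriv) z 0
    simpa [h0] using this
  have hexp : ∀ z, f z = Complex.exp (a * z) := by
    intro z
    have h1 := hconst z
    rw [Complex.exp_neg] at h1
    exact (mul_inv_eq_one₀ (Complex.exp_ne_zero _)).1 h1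
  -- Now `f z = exp (a z)`, and the period condition `exp (2πi a) = 1` forces `a` to be an integer.
  rw [hexp, Complex.exp_eq_one_iff] at hp
  obtain ⟨n, hn⟩ := hp
  have han : a = n := mul_right_cancel₀ Complex.two_pi_I_ne_zero hn
  exact ⟨n, fun z => by rw [hexp, han, Complex.exp_int_mul]⟩

/-- Composing `χ` with `w ↦ mulSingle k (exp w)` gives an entire homomorphism of period `2πi`, to
which `exists_int_of_exp_hom` applies; since every `z : ℂˣ` is `exp (log z)`, the exponent found for
`exp` serves on all of `ℂˣ`. -/
theorem exists_zpow_mulSingle (χ : CharGroup p) (k : Fin p) :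
    ∃ n : ℤ, ∀ z : ℂˣ, χ.1 (Pi.mulSingle (M := fun _ : Fin p => ℂˣ) k z : Fin p → ℂˣ) = z ^ n := by
  let e : ℂ → ℂˣ := fun w => Units.mk0 (Complex.exp w) (Complex.exp_ne_zero w)
  let s : ℂ → Torus p := fun w => (Pi.mulSingle k (e w) : Fin p → ℂˣ)
  have hs : ContMDiff 𝓘(ℂ, ℂ) 𝓘(ℂ, Fin p → ℂ) ω s := by
    intro w
    rw [Torus.contMDiffAt_iff_apply]
    intro j
    by_cases hj : j = k
    · subst hj
      have : ContDiffAt ℂ ω Complex.exp w := Complex.contDiff_exp.contDiffAt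
      simpa [s, e] using this.contMDiffAt
    · simpa [s, Pi.mulSingle_eq_of_ne hj] using contMDiffAt_const
  have hs_add : ∀ z w, s (z + w) = s z * s w := by
    intro z w
    have : e (z + w) = e z * e w := Units.ext (Complex.exp_add z w)
    simp only [s, this, Pi.mulSingle_mul]
    rfl
  have hs0 : s 0 = 1 := by
    have : e 0 = 1 := Units.ext Complex.exp_zero
    simp only [s, this, Pi.mulSingle_one]
    rfl
  have hsp : s (2 * Real.pi * Complex.I) = 1 := by
    have : e (2 * Real.pi * Complex.I) = 1 := Units.ext Complex.exp_two_pi_mul_I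
    simp only [s, this, Pi.mulSingle_one]
    rfl
  obtain ⟨n, hn⟩ := exists_int_of_exp_hom (f := fun w => (χ.1 (s w) : ℂ))
    (((contMDiff_char χ).comp hs).contDiff.differentiable (by simp))
    (fun z w => by simp only [hs_add, map_mul, Units.val_mul])
    (by simp only [hs0, map_one, Units.val_one]) (by simp only [hsp, map_one, Units.val_one])
  refine ⟨n, fun z => ?_⟩
  have hz : z = e (Complex.log z) := Units.ext (Complex.exp_log z.ne_zero).symm
  ext
  rw [hz]
  simpa [e] using hn (Complex.log z)

/-- Every holomorphic character of `(ℂˣ)ᵖ` is a monomial. -/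
theorem exists_eq_prod_coordChar (χ : CharGroup p) :
    ∃ n : Fin p → ℤ, χ = ∏ k, coordChar k ^ n k := by
  choose n hn using exists_zpow_mulSingle χ
  refine ⟨n, Subtype.ext (MonoidHom.ext fun h => ?_)⟩
  have h1 : h = ∏ k, (Pi.mulSingle k (h k) : Fin p → ℂˣ) :=
    (Finset.univ_prod_mulSingle (fun k => h k)).symm
  have h2 : χ.1 h = ∏ k, h k ^ n k := by
    conv_lhs => rw [h1]
    erw [map_prod χ.1]
    exact Finset.prod_congr rfl fun k _ => hn k (h k)
  rw [h2, Subgroup.val_finsetProd, MonoidHom.finsetProd_apply]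
  rfl

/-- A homomorphism out of the character group is determined by the coordinate characters. -/
theorem charGroup_hom_ext {G : Type*} [CommGroup G] {f g : CharGroup p →* G}
    (h : ∀ k, f (coordChar k) = g (coordChar k)) : f = g := by
  ext χ
  obtain ⟨n, rfl⟩ := exists_eq_prod_coordChar χ
  simp only [map_prod, map_zpow, h]

end TorusCalculus

/-! ### Transition functions and isomorphisms of principal bundles -/

namespace PrincipalBundle

variable {p : ℕ} {E X : Type u} [NormedAddCommGroup E] [NormedSpace ℂ E]
  [TopologicalSpace X] [ChartedSpace E X] (P Q : PrincipalBundle p E X)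

theorem contMDiffAt_triv {i : X} {m : P.M} (hm : P.proj m ∈ (P.triv i).baseSet) :
    ContMDiffAt 𝓘(ℂ, E × (Fin p → ℂ)) (𝓘(ℂ, E).prod 𝓘(ℂ, Fin p → ℂ)) ω (P.triv i) m :=
  (P.exists_trivialization i).choose_spec.2.1.contMDiffAt
    ((P.triv i).open_source.mem_nhds ((P.triv i).mem_source.2 hm))

theorem contMDiffAt_triv_symm {i x : X} (hx : x ∈ (P.triv i).baseSet) (h : Torus p) :
    ContMDiffAt (𝓘(ℂ, E).prod 𝓘(ℂ, Fin p → ℂ)) 𝓘(ℂ, E × (Fin p → ℂ)) ω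
      (P.triv i).toOpenPartialHomeomorph.symm (x, h) :=
  (P.exists_trivialization i).choose_spec.2.2.1.contMDiffAt
    ((P.triv i).open_target.mem_nhds ((P.triv i).mem_target.2 hx))

/-- The fibre coordinate of the chosen trivialization near `i`. -/
def fib (i : X) (m : P.M) : Torus p := (P.triv i m).2

theorem triv_apply {i : X} {m : P.M} (hm : P.proj m ∈ (P.triv i).baseSet) :
    P.triv i m = (P.proj m, P.fib i m) :=
  Prod.ext ((P.triv i).coe_fst' hm) rfl

theorem baseSet_mem_nhds {i x : X} (hx : x ∈ (P.triv i).baseSet) : (P.triv i).baseSet ∈ 𝓝 x :=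
  (P.triv i).open_baseSet.mem_nhds hx

theorem contMDiff_proj : ContMDiff 𝓘(ℂ, E × (Fin p → ℂ)) 𝓘(ℂ, E) ω P.proj := by
  intro m
  have hm := P.mem_triv (P.proj m)
  refine (contMDiffAt_fst.comp m (P.contMDiffAt_triv hm)).congr_of_eventuallyEq ?_
  filter_upwards [(P.triv (P.proj m)).open_source.mem_nhds ((P.triv _).mem_source.2 hm)] with y hy
  exact ((P.triv (P.proj m)).coe_fst hy).symm

theorem contMDiffAt_fib {i : X} {m : P.M} (hm : P.proj m ∈ (P.triv i).baseSet) :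
    ContMDiffAt 𝓘(ℂ, E × (Fin p → ℂ)) 𝓘(ℂ, Fin p → ℂ) ω (P.fib i) m :=
  contMDiffAt_snd.comp m (P.contMDiffAt_triv hm)

theorem proj_preimage_mem_nhds {m : P.M} {s : Set X} (hs : s ∈ 𝓝 (P.proj m)) :
    P.proj ⁻¹' s ∈ 𝓝 m :=
  P.contMDiff_proj.continuous.continuousAt hs

theorem fib_smul {i : X} (h : Torus p) {m : P.M} (hm : P.proj m ∈ (P.triv i).baseSet) :
    P.fib i (h • m) = h * P.fib i m :=
  P.triv_smul h hm

theorem fib_sec {i x : X} (hx : x ∈ (P.triv i).baseSet) : P.fib i (P.sec i x) = 1 :=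
  congrArg Prod.snd (P.triv_sec hx)

theorem ext_of_fib {i : X} {m m' : P.M} (hm : P.proj m ∈ (P.triv i).baseSet)
    (h : P.proj m = P.proj m') (h' : P.fib i m = P.fib i m') : m = m' := by
  refine (P.triv i).injOn ((P.triv i).mem_source.2 hm) ((P.triv i).mem_source.2 (h ▸ hm)) ?_
  rw [Trivialization.coe_coe, P.triv_apply hm, P.triv_apply (h ▸ hm), h, h']

theorem triv_symm_eq {i x : X} (hx : x ∈ (P.triv i).baseSet) (h : Torus p) :
    (P.triv i).toOpenPartialHomeomorph.symm (x, h) = h • P.sec i x := by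
  have h1 : P.proj ((P.triv i).toOpenPartialHomeomorph.symm (x, h)) = x :=
    (P.triv i).proj_symm_apply' hx
  refine P.ext_of_fib (i := i) (by rwa [h1]) (by rw [h1, P.proj_smul, P.proj_sec hx]) ?_
  rw [P.fib_smul _ (by rwa [P.proj_sec hx]), P.fib_sec hx, mul_one]
  exact congrArg Prod.snd ((P.triv i).apply_symm_apply' hx)

theorem fib_smul_sec {i : X} {m : P.M} (hm : P.proj m ∈ (P.triv i).baseSet) :
    P.fib i m • P.sec i (P.proj m) = m := by
  refine P.ext_of_fib (i := i) (by rwa [P.proj_smul, P.proj_sec hm])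
    (by rw [P.proj_smul, P.proj_sec hm]) ?_
  rw [P.fib_smul _ (by rwa [P.proj_sec hm]), P.fib_sec hm, mul_one]

/-- The transition function between the chosen trivializations near `i` and near `j`. -/
def trans (i j x : X) : Torus p := P.fib j (P.sec i x)

/-- This fixes the convention `t_j = t_i T_ij` for fibre coordinates. It follows from equivariance
applied to `m = t_i • s_i`. -/
theorem fib_eq_mul_trans {i j : X} {m : P.M} (hi : P.proj m ∈ (P.triv i).baseSet)
    (hj : P.proj m ∈ (P.triv j).baseSet) : P.fib j m = P.fib i m * P.trans i j (P.proj m) := by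
  conv_lhs => rw [← P.fib_smul_sec hi]
  rw [P.fib_smul _ (by rwa [P.proj_sec hi]), trans]

theorem sec_eq_trans_smul {i j x : X} (hi : x ∈ (P.triv i).baseSet)
    (hj : x ∈ (P.triv j).baseSet) : P.sec i x = P.trans i j x • P.sec j x := by
  have h := P.fib_smul_sec (m := P.sec i x) (i := j) (by rwa [P.proj_sec hi])
  rw [P.proj_sec hi] at h
  exact h.symm

theorem contMDiffAt_sec {i x : X} (hx : x ∈ (P.triv i).baseSet) :
    ContMDiffAt 𝓘(ℂ, E) 𝓘(ℂ, E × (Fin p → ℂ)) ω (P.sec i) x :=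
  (P.contMDiffAt_triv_symm hx 1).comp x
    (contMDiffAt_id.prodMk (contMDiffAt_const (c := (1 : Torus p))))

theorem contMDiffAt_trans {i j x : X} (hi : x ∈ (P.triv i).baseSet)
    (hj : x ∈ (P.triv j).baseSet) :
    ContMDiffAt 𝓘(ℂ, E) 𝓘(ℂ, Fin p → ℂ) ω (P.trans i j) x :=
  (P.contMDiffAt_fib (i := j) (by rwa [P.proj_sec hi])).comp x (P.contMDiffAt_sec hi)

theorem contMDiff_smul (h : Torus p) :
    ContMDiff 𝓘(ℂ, E × (Fin p → ℂ)) 𝓘(ℂ, E × (Fin p → ℂ)) ω (fun m : P.M => h • m) := by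
  intro m
  have hm := P.mem_triv (P.proj m)
  have h1 := (P.contMDiffAt_triv_symm hm (h * P.fib (P.proj m) m)).comp m
    (P.contMDiff_proj.contMDiffAt.prodMk
      (Torus.contMDiffAt_mul (contMDiffAt_const (c := h)) (P.contMDiffAt_fib hm)))
  refine h1.congr_of_eventuallyEq ?_
  filter_upwards [P.proj_preimage_mem_nhds (P.baseSet_mem_nhds hm)] with y hy
  change h • y = (P.triv (P.proj m)).toOpenPartialHomeomorph.symm (P.proj y, h * P.fib _ y)
  rw [P.triv_symm_eq hy, mul_smul, P.fib_smul_sec hy]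

variable {P Q}

/-- The fibrewise map `P → Q` which multiplies the fibre coordinates by `C`. -/
def cocycleMap (C : X → X → Torus p) (m : P.M) : Q.M :=
  (C (P.proj m) (P.proj m) * P.fib (P.proj m) m) • Q.sec (P.proj m) (P.proj m)

theorem proj_cocycleMap (C : X → X → Torus p) (m : P.M) :
    Q.proj (cocycleMap C m : Q.M) = P.proj m := by
  rw [cocycleMap, Q.proj_smul, Q.proj_sec (Q.mem_triv _)]

theorem cocycleMap_smul (C : X → X → Torus p) (h : Torus p) (m : P.M) :
    (cocycleMap C (h • m) : Q.M) = h • cocycleMap C m := by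
  rw [cocycleMap, cocycleMap, P.proj_smul, P.fib_smul _ (P.mem_triv _), smul_smul]
  congr 1
  exact mul_left_comm _ _ _

theorem fib_cocycleMap_self (C : X → X → Torus p) (m : P.M) :
    Q.fib (P.proj m) (cocycleMap C m : Q.M) =
      C (P.proj m) (P.proj m) * P.fib (P.proj m) m := by
  have h := Q.mem_triv (P.proj m)
  rw [cocycleMap, Q.fib_smul _ (by rwa [Q.proj_sec h]), Q.fib_sec h, mul_one]

/-- In the definition of `cocycleMap` the trivialization is centred at `P.proj m` and so varies with
`m`. The coboundary relation `hC` makes the formula independent of the index, and only with a fixed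
`i` can holomorphy be read off. -/
theorem cocycleMap_eq {C : X → X → Torus p}
    (hC : ∀ i j x, x ∈ (P.triv i).baseSet → x ∈ (Q.triv i).baseSet → x ∈ (P.triv j).baseSet →
      x ∈ (Q.triv j).baseSet → C i x * Q.trans i j x = P.trans i j x * C j x) {i : X} {m : P.M}
    (hP : P.proj m ∈ (P.triv i).baseSet) (hQ : P.proj m ∈ (Q.triv i).baseSet) :
    (cocycleMap C m : Q.M) = (C i (P.proj m) * P.fib i m) • Q.sec i (P.proj m) := by
  have kP := P.mem_triv (P.proj m)
  have kQ := Q.mem_triv (P.proj m)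
  rw [cocycleMap, Q.sec_eq_trans_smul kQ hQ, smul_smul]
  congr 1
  rw [P.fib_eq_mul_trans kP hP, mul_right_comm, hC _ _ _ kP kQ hP hQ]
  ac_rfl

theorem contMDiff_cocycleMap {C : X → X → Torus p}
    (hC : ∀ i j x, x ∈ (P.triv i).baseSet → x ∈ (Q.triv i).baseSet → x ∈ (P.triv j).baseSet →
      x ∈ (Q.triv j).baseSet → C i x * Q.trans i j x = P.trans i j x * C j x)
    (hs : ∀ i, ContMDiffAt 𝓘(ℂ, E) 𝓘(ℂ, Fin p → ℂ) ω (C i) i) :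
    ContMDiff 𝓘(ℂ, E × (Fin p → ℂ)) 𝓘(ℂ, E × (Fin p → ℂ)) ω (cocycleMap C : P.M → Q.M) := by
  intro m
  have hP := P.mem_triv (P.proj m)
  have hQ := Q.mem_triv (P.proj m)
  -- Every point of `X` is itself an index, so taking `i = P.proj m` requires holomorphy of `C i` at
  -- the point `i` only.
  have h1 := (Q.contMDiffAt_triv_symm hQ (C (P.proj m) (P.proj m) * P.fib (P.proj m) m)).comp m
    (P.contMDiff_proj.contMDiffAt.prodMk
      (Torus.contMDiffAt_mul ((hs (P.proj m)).comp m P.contMDiff_proj.contMDiffAt)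
        (P.contMDiffAt_fib hP)))
  refine h1.congr_of_eventuallyEq ?_
  filter_upwards [P.proj_preimage_mem_nhds (P.baseSet_mem_nhds hP),
    P.proj_preimage_mem_nhds (Q.baseSet_mem_nhds hQ)] with y hy hy'
  exact (cocycleMap_eq hC hy hy').trans (Q.triv_symm_eq hy' _).symm

theorem cocycleMap_comp {C C' : X → X → Torus p} (h : ∀ x, C' x x * C x x = 1) (m : P.M) :
    (cocycleMap C' (cocycleMap C m : Q.M) : P.M) = m := by
  refine P.ext_of_fib (i := P.proj m) ?_ ?_ ?_
  · rw [proj_cocycleMap, proj_cocycleMap]; exact P.mem_triv _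
  · rw [proj_cocycleMap, proj_cocycleMap]
  · have h1 := fib_cocycleMap_self (Q := P) C' (cocycleMap C m : Q.M)
    rw [proj_cocycleMap, fib_cocycleMap_self, ← mul_assoc, h, one_mul] at h1
    exact h1

/-- Principal bundles with cohomologous transition functions are isomorphic. -/
theorem isom_of_cocycle {C : X → X → Torus p}
    (hC : ∀ i j x, x ∈ (P.triv i).baseSet → x ∈ (Q.triv i).baseSet → x ∈ (P.triv j).baseSet →
      x ∈ (Q.triv j).baseSet → C i x * Q.trans i j x = P.trans i j x * C j x)
    (hs : ∀ i, ContMDiffAt 𝓘(ℂ, E) 𝓘(ℂ, Fin p → ℂ) ω (C i) i) : P.Isom Q := by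
  refine ⟨⟨⟨cocycleMap C, cocycleMap (fun i x => (C i x)⁻¹), fun m => ?_, fun m => ?_⟩,
    contMDiff_cocycleMap hC hs, contMDiff_cocycleMap (fun i j x h1 h2 h3 h4 => ?_)
      fun i => Torus.contMDiffAt_inv (hs i)⟩, proj_cocycleMap C, cocycleMap_smul C⟩
  · exact cocycleMap_comp (fun x => inv_mul_cancel _) m
  · exact cocycleMap_comp (fun x => mul_inv_cancel _) m
  · rw [inv_mul_eq_iff_eq_mul, ← mul_assoc, hC i j x h2 h1 h4 h3, mul_inv_cancel_right]

/-- Principal bundles with isomorphic line bundles attached to the coordinate characters are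
isomorphic. -/
theorem isom_of_assoc_isom (h : ∀ k, (P.assoc (coordChar k)).Isom (Q.assoc (coordChar k))) :
    P.Isom Q := by
  classical
  choose c hc h0 hcc using fun k => (h k).exists_cocycle
  let C : X → X → Torus p := fun i x k => if hx : c k i x ≠ 0 then Units.mk0 _ hx else 1
  have hCc : ∀ k i x, x ∈ (P.triv i).baseSet → x ∈ (Q.triv i).baseSet → (C i x k : ℂ) = c k i x := by
    intro k i x h1 h2
    simp only [C]
    rw [dif_pos (h0 k i x h1 h2), Units.val_mk0]
  refine isom_of_cocycle (C := C) (fun i j x h1 h2 h3 h4 => ?_) fun i => ?_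
  · funext k
    ext
    have e := hcc k i j x h1 h2 h3 h4
    rw [assoc_trans _ _ h1 h3, assoc_trans _ _ h2 h4] at e
    change (C i x k : ℂ) * (Q.trans i j x k : ℂ) = (P.trans i j x k : ℂ) * (C j x k : ℂ)
    rw [hCc k i x h1 h2, hCc k j x h3 h4]
    exact e
  · rw [Torus.contMDiffAt_iff_apply]
    intro k
    refine (hc k i).congr_of_eventuallyEq ?_
    filter_upwards [P.baseSet_mem_nhds (P.mem_triv i), Q.baseSet_mem_nhds (Q.mem_triv i)] with x h1 h2
    exact hCc k i x h1 h2

/-- A principal bundle is determined up to isomorphism by its character map. -/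
theorem isom_of_charMap_eq (h : P.charMap = Q.charMap) : P.Isom Q :=
  isom_of_assoc_isom fun k => Quotient.exact (DFunLike.congr_fun h (coordChar k))

end PrincipalBundle

/-! ### Manifold structure on a space glued from pieces of a manifold -/

section ComposedCharts

variable {V H N M : Type*} [NormedAddCommGroup V] [NormedSpace ℂ V] [TopologicalSpace H]
  (I : ModelWithCorners ℂ V H) [TopologicalSpace N] [ChartedSpace H N] [IsManifold I ω N]
  [TopologicalSpace M] [ChartedSpace N M]

/-- If `M` is glued from open pieces of the manifold `N` by smooth maps, it is a manifold. -/
theorem isManifold_comp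
    (h : ∀ t t' : OpenPartialHomeomorph M N, t ∈ atlas N M → t' ∈ atlas N M →
      ContMDiffOn I I ω (t.symm ≫ₕ t') (t.symm ≫ₕ t').source) :
    letI := ChartedSpace.comp H N M
    IsManifold I ω M := by
  let := ChartedSpace.comp H N M
  refine isManifold_of_contDiffOn I ω M ?_
  rintro _ _ ⟨t, ht, c, hc, rfl⟩ ⟨t', ht', c', hc', rfl⟩
  have h1 := contMDiffOn_symm_of_mem_maximalAtlas (I := I) (n := ω)
    (IsManifold.subset_maximalAtlas hc)
  have h2 := h t t' ht ht'
  have h3 := contMDiffOn_of_mem_maximalAtlas (I := I) (n := ω)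
    (IsManifold.subset_maximalAtlas hc')
  -- A change of composed charts is `c' ∘ (t' ∘ t⁻¹) ∘ c⁻¹`, a composite of three smooth maps.
  have h4 : ContMDiffOn I I ω ((t ≫ₕ c).symm ≫ₕ t' ≫ₕ c')
      ((t ≫ₕ c).symm ≫ₕ t' ≫ₕ c').source := by
    intro y hy
    simp only [mfld_simps] at hy
    refine ContMDiffAt.contMDiffWithinAt ?_
    have k1 := h1.contMDiffAt (c.open_target.mem_nhds hy.1.1)
    have k2 : ContMDiffAt I I ω (t.symm ≫ₕ t') (c.symm y) :=
      h2.contMDiffAt ((t.symm ≫ₕ t').open_source.mem_nhds (by simp only [mfld_simps]; tauto))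
    have k3 : ContMDiffAt I I ω c' ((t.symm ≫ₕ t') (c.symm y)) :=
      h3.contMDiffAt (c'.open_source.mem_nhds (by simp only [mfld_simps]; tauto))
    exact ContMDiffAt.comp (f := (t.symm ≫ₕ t') ∘ c.symm) y k3 (k2.comp y k1)
  -- Charts of the model space are identities, so `contMDiffOn_iff` at any point `y : H` turns `h4`
  -- into the required `ContDiffOn` statement. If `H` is empty there is no such `y`, but then
  -- nothing is to be proved.
  have h5 := fun y : H => (contMDiffOn_iff.1 h4).2 y y
  rcases isEmpty_or_nonempty H with hH | ⟨⟨y⟩⟩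
  · intro v hv
    exact (hH.false (I.symm v)).elim
  · refine (h5 y).mono fun v hv => ?_
    have hs : chartAt H y = OpenPartialHomeomorph.refl H := chartAt_self_eq
    simp only [mfld_simps, hs] at hv ⊢
    tauto

/-- Near `x`, the map `t` is `(chartAt H (t x))⁻¹ ∘ (chartAt H (t x) ∘ t)`, and the second factor is
by construction a chart of `M`. The inverse of `t` is treated in the same way. -/
theorem contMDiffOn_atlas_comp
    (h : letI := ChartedSpace.comp H N M
      IsManifold I ω M) {t : OpenPartialHomeomorph M N} (ht : t ∈ atlas N M) :
    letI := ChartedSpace.comp H N M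
    ContMDiffOn I I ω t t.source ∧ ContMDiffOn I I ω t.symm t.target := by
  let := ChartedSpace.comp H N M
  have he : ∀ y : N, t ≫ₕ chartAt H y ∈ atlas H M := fun y => ⟨t, ht, _, chart_mem_atlas H y, rfl⟩
  constructor
  · intro x hx
    have k1 : ContMDiffAt I I ω (t ≫ₕ chartAt H (t x)) x :=
      (contMDiffOn_of_mem_maximalAtlas (IsManifold.subset_maximalAtlas (he (t x)))).contMDiffAt
        ((t ≫ₕ chartAt H (t x)).open_source.mem_nhds (by simp [hx]))
    have k2 : ContMDiffAt I I ω (chartAt H (t x)).symm ((t ≫ₕ chartAt H (t x)) x) :=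
      contMDiffOn_chart_symm.contMDiffAt ((chartAt H (t x)).open_target.mem_nhds (by simp))
    refine ((k2.comp x k1).congr_of_eventuallyEq ?_).contMDiffWithinAt
    filter_upwards [(t ≫ₕ chartAt H (t x)).open_source.mem_nhds
      (show x ∈ (t ≫ₕ chartAt H (t x)).source by simp [hx])] with y hy
    simp only [mfld_simps] at hy
    simp [hy.2]
  · intro y hy
    have k1 : ContMDiffAt I I ω (chartAt H y) y :=
      contMDiffOn_chart.contMDiffAt (chart_source_mem_nhds H y)
    have k2 : ContMDiffAt I I ω (t ≫ₕ chartAt H y).symm (chartAt H y y) :=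
      (contMDiffOn_symm_of_mem_maximalAtlas
        (IsManifold.subset_maximalAtlas (he y))).contMDiffAt
        ((t ≫ₕ chartAt H y).open_target.mem_nhds (by simp [hy]))
    refine ((k2.comp y k1).congr_of_eventuallyEq ?_).contMDiffWithinAt
    filter_upwards [chart_source_mem_nhds H y] with z hz
    simp [hz]

end ComposedCharts

/-! ### Principal bundles glued from cocycles and from line bundles -/

namespace HolLineBundle

variable {E X : Type u} [NormedAddCommGroup E] [NormedSpace ℂ E]
  [TopologicalSpace X] [ChartedSpace E X] (L : HolLineBundle E X)

theorem trans_mul {j x : X} (hj : x ∈ L.U j) (k i : X) :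
    L.coord j x (L.frame i x) * L.coord k x (L.frame j x) = L.coord k x (L.frame i x) := by
  rw [← smul_eq_mul, ← map_smul, L.coord_smul_frame hj]

open Classical in
/-- The transition function of a line bundle as an invertible number. -/
def transUnit (i j x : X) : ℂˣ :=
  if h : L.coord j x (L.frame i x) ≠ 0 then Units.mk0 _ h else 1

theorem transUnit_val {i j x : X} (hi : x ∈ L.U i) (hj : x ∈ L.U j) :
    (L.transUnit i j x : ℂ) = L.coord j x (L.frame i x) := by
  rw [transUnit, dif_pos (right_ne_zero_of_mul_eq_one (L.trans_mul_trans hi hj)), Units.val_mk0]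

end HolLineBundle

/-- A holomorphic `(ℂˣ)ᵖ`-valued cocycle on `X`. -/
structure TorusCocycle (p : ℕ) (E X : Type u) [NormedAddCommGroup E] [NormedSpace ℂ E]
    [TopologicalSpace X] [ChartedSpace E X] where
  U : X → Set X
  isOpen_U : ∀ i, IsOpen (U i)
  mem_U : ∀ i, i ∈ U i
  T : X → X → X → Torus p
  T_self : ∀ i x, x ∈ U i → T i i x = 1
  T_mul : ∀ i j k x, x ∈ U i → x ∈ U j → x ∈ U k → T i j x * T j k x = T i k x
  holomorphic : ∀ i j x, x ∈ U i → x ∈ U j → ContMDiffAt 𝓘(ℂ, E) 𝓘(ℂ, Fin p → ℂ) ω (T i j) x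

namespace TorusCocycle

variable {p : ℕ} {E X : Type u} [NormedAddCommGroup E] [NormedSpace ℂ E]
  [TopologicalSpace X] [ChartedSpace E X] (A : TorusCocycle p E X)

theorem contMDiffAt_change {i j : X} {q : X × Torus p} (hi : q.1 ∈ A.U i) (hj : q.1 ∈ A.U j) :
    ContMDiffAt (𝓘(ℂ, E).prod 𝓘(ℂ, Fin p → ℂ)) 𝓘(ℂ, Fin p → ℂ) ω
      (fun q : X × Torus p => q.2 * A.T i j q.1) q :=
  Torus.contMDiffAt_mul contMDiffAt_snd ((A.holomorphic i j q.1 hi hj).comp q contMDiffAt_fst)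

/-- The fibre bundle with fibre `(ℂˣ)ᵖ` glued by the cocycle. -/
def core : FiberBundleCore X X (Torus p) where
  baseSet := A.U
  isOpen_baseSet := A.isOpen_U
  indexAt := id
  mem_baseSet_at := A.mem_U
  coordChange i j x h := h * A.T i j x
  coordChange_self i x hx h := by rw [A.T_self i x hx, mul_one]
  continuousOn_coordChange i j q hq :=
    (A.contMDiffAt_change hq.1.1 hq.1.2).continuousAt.continuousWithinAt
  coordChange_comp i j k x hx h := by rw [mul_assoc, A.T_mul i j k x hx.1.1 hx.1.2 hx.2]

/-- The total space of the principal bundle glued by the cocycle. -/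
def Total : Type u := TotalSpace (Torus p) A.core.Fiber

instance : TopologicalSpace A.Total :=
  inferInstanceAs (TopologicalSpace (TotalSpace (Torus p) A.core.Fiber))

/-- The projection to the base. -/
def proj (m : A.Total) : X := m.1

/-- The coordinate on the fibre over `x` given by the trivialization near `x`. -/
def fib (m : A.Total) : Torus p := m.2

/-- The point over `x` with the given fibre coordinate. -/
def point (x : X) (h : Torus p) : A.Total := ⟨x, h⟩

/-- The local trivializations of the glued bundle. -/
def triv (i : X) : Trivialization (Torus p) A.proj := A.core.localTriv i

theorem triv_apply (i : X) (m : A.Total) : A.triv i m = (A.proj m, A.fib m * A.T (A.proj m) i (A.proj m)) := rfl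

/-- The local trivializations are first taken as charts with values in the manifold `X × Torus p`;
composing them with the charts of that product gives the complex manifold structure. -/
instance : ChartedSpace (X × Torus p) A.Total where
  atlas := range fun i => (A.triv i).toOpenPartialHomeomorph
  chartAt m := (A.triv m.1).toOpenPartialHomeomorph
  mem_chart_source m := (A.triv m.1).mem_source.2 (A.mem_U m.1)
  chart_mem_atlas m := ⟨m.1, rfl⟩

theorem triv_mem_atlas (i : X) :
    (A.triv i).toOpenPartialHomeomorph ∈ atlas (X × Torus p) A.Total := ⟨i, rfl⟩

instance : ChartedSpace (ModelProd E (Fin p → ℂ)) A.Total :=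
  ChartedSpace.comp (ModelProd E (Fin p → ℂ)) (X × Torus p) A.Total

/-- `ModelProd` is the product under another name. The two models with corners, `𝓘(ℂ, E).prod 𝓘(ℂ,
Fin p → ℂ)` and `𝓘(ℂ, E × (Fin p → ℂ))`, are identified by `modelWithCornersSelf_prod`. -/
instance : ChartedSpace (E × (Fin p → ℂ)) A.Total :=
  inferInstanceAs (ChartedSpace (ModelProd E (Fin p → ℂ)) A.Total)

instance : MulAction (Torus p) A.Total where
  smul h m := A.point (A.proj m) (h * A.fib m)
  one_smul m := congrArg (A.point (A.proj m)) (one_mul (A.fib m))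
  mul_smul h k m := congrArg (A.point (A.proj m)) (mul_assoc h k (A.fib m))

theorem triv_smul (i : X) (h : Torus p) (m : A.Total) :
    A.triv i (h • m) = (A.proj m, h * (A.triv i m).2) :=
  Prod.ext rfl (mul_assoc h (A.fib m) _)

theorem triv_snd {i j : X} {m : A.Total} (hi : A.proj m ∈ A.U i) (hj : A.proj m ∈ A.U j) :
    (A.triv j m).2 = (A.triv i m).2 * A.T i j (A.proj m) := by
  rw [A.triv_apply, A.triv_apply, mul_assoc, A.T_mul _ _ _ _ (A.mem_U _) hi hj]

section

variable [IsManifold 𝓘(ℂ, E) ω X]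

theorem isManifold_prod : IsManifold (𝓘(ℂ, E).prod 𝓘(ℂ, Fin p → ℂ)) ω A.Total := by
  refine isManifold_comp (N := X × Torus p) _ ?_
  rintro _ _ ⟨i, rfl⟩ ⟨j, rfl⟩ q hq
  have hq' : q ∈ (A.triv i).target ∧
    (A.triv i).toOpenPartialHomeomorph.symm q ∈ (A.triv j).source := by simpa using hq
  have hi : q.1 ∈ A.U i := (A.triv i).mem_target.1 hq'.1
  have hj : q.1 ∈ A.U j := (A.triv j).mem_source.1 hq'.2
  refine ContMDiffAt.contMDiffWithinAt ?_
  refine (contMDiffAt_fst.prodMk (A.contMDiffAt_change hi hj)).congr_of_eventuallyEq ?_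
  filter_upwards [continuousAt_fst ((A.isOpen_U i).mem_nhds hi),
    continuousAt_fst ((A.isOpen_U j).mem_nhds hj)] with y h1 h2
  -- The fibre over a point is modelled on the index which is that point, so the change from `i` to
  -- `j` unfolds as a passage through the index `y.1`; the cocycle identity removes it.
  change (y.1, y.2 * A.T i y.1 y.1 * A.T y.1 j y.1) = (y.1, y.2 * A.T i j y.1)
  rw [mul_assoc, A.T_mul i y.1 j y.1 h1 (A.mem_U y.1) h2]

instance : IsManifold 𝓘(ℂ, E × (Fin p → ℂ)) ω A.Total := by
  rw [modelWithCornersSelf_prod]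
  exact A.isManifold_prod

theorem contMDiffOn_triv (i : X) :
    ContMDiffOn 𝓘(ℂ, E × (Fin p → ℂ)) (𝓘(ℂ, E).prod 𝓘(ℂ, Fin p → ℂ)) ω (A.triv i)
      (A.triv i).source ∧
    ContMDiffOn (𝓘(ℂ, E).prod 𝓘(ℂ, Fin p → ℂ)) 𝓘(ℂ, E × (Fin p → ℂ)) ω
      (A.triv i).toOpenPartialHomeomorph.symm (A.triv i).target := by
  rw [modelWithCornersSelf_prod]
  exact contMDiffOn_atlas_comp (N := X × Torus p) _ A.isManifold_prod (A.triv_mem_atlas i)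

/-- The principal bundle glued by the cocycle. -/
def bundle : PrincipalBundle p E X where
  M := A.Total
  proj := A.proj
  proj_smul _ _ := rfl
  exists_trivialization i := ⟨A.triv i, A.mem_U i, (A.contMDiffOn_triv i).1,
    (A.contMDiffOn_triv i).2, fun h m _ => A.triv_smul i h m⟩

theorem assoc_bundle_isom (L : HolLineBundle E X) (χ : CharGroup p) (hU : ∀ i, A.U i ⊆ L.U i)
    (h : ∀ i j x, x ∈ A.U i → x ∈ A.U j → L.coord j x (L.frame i x) = (χ.1 (A.T i j x) : ℂ)) :
    (A.bundle.assoc χ).Isom L := by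
  have hp : ∀ {i x}, x ∈ (A.bundle.triv i).baseSet → A.proj (A.bundle.sec i x) = x :=
    fun hx => A.bundle.proj_sec hx
  have hx := A.mem_U
  -- The trivializations `A.bundle.triv i` come from a choice and need not be `A.triv i`. The
  -- isomorphism sends `[m, 1]` over `x` to `χ(t) L.frame x x`, with `t` the coordinate of `m` in
  -- `A.triv x`. The witness is the `i`-coordinate of the image of `[sec i x, 1]`. The index `x` is
  -- used because `x ∈ A.U x` always holds, whereas the chosen base set near `i` need not lie in
  -- `A.U i`.
  refine HolLineBundle.isom_of_cocycle
    (fun i x => (χ.1 (A.triv x (A.bundle.sec i x)).2 : ℂ) * L.coord i x (L.frame x x)) (fun i => ?_)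
    (fun i x h1 h2 => mul_ne_zero (Units.ne_zero _)
      (left_ne_zero_of_mul_eq_one (L.trans_mul_trans h2 (L.mem_U x)))) fun i j x h1 h2 h3 h4 => ?_
  · have hi := A.bundle.mem_triv i
    have h1 := (A.contMDiffOn_triv i).1.contMDiffAt ((A.triv i).open_source.mem_nhds
      ((A.triv i).mem_source.2 (show A.proj (A.bundle.sec i i) ∈ A.U i by
        rw [hp hi]; exact A.mem_U i)))
    have h2 := contMDiffAt_snd.comp i (h1.comp i (A.bundle.contMDiffAt_sec hi))
    refine ((contMDiff_char χ).contMDiffAt.comp i h2).congr_of_eventuallyEq ?_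
    filter_upwards [(A.isOpen_U i).mem_nhds (A.mem_U i), A.bundle.baseSet_mem_nhds hi] with x h3 h4
    -- Near `i` the moving index can be exchanged for `i`: the factor `χ(T i x x)` so produced
    -- cancels `L.coord i x (L.frame x x)`, leaving a visibly holomorphic function.
    have e := A.triv_snd (i := i) (j := x) (m := A.bundle.sec i x)
      (by rwa [hp h4]) (by rw [hp h4]; exact hx x)
    rw [e, hp h4, map_mul, Units.val_mul, ← h i x x h3 (hx x), mul_assoc,
      L.trans_mul_trans (hU x (hx x)) (hU i h3), mul_one]
    rfl
  · have h1' : x ∈ (A.bundle.triv i).baseSet := h1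
    have h3' : x ∈ (A.bundle.triv j).baseSet := h3
    have e := (congrArg (fun m => (A.triv x m).2) (A.bundle.sec_eq_trans_smul h1' h3')).trans
      (congrArg Prod.snd (A.triv_smul x (A.bundle.trans i j x) (A.bundle.sec j x)))
    rw [PrincipalBundle.assoc_trans _ _ h1' h3']
    dsimp only at e ⊢
    rw [e, map_mul, Units.val_mul, mul_assoc, mul_assoc, L.trans_mul h2 j x]
    rfl

end

/-- The cocycle formed by the transition functions of `p` line bundles. -/
def ofLineBundles (L : Fin p → HolLineBundle E X) : TorusCocycle p E X where
  U i := ⋂ k, (L k).U i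
  isOpen_U i := isOpen_iInter_of_finite fun k => (L k).frames.isOpen_U i
  mem_U i := mem_iInter.2 fun k => (L k).mem_U i
  T i j x k := (L k).transUnit i j x
  T_self i x hx := funext fun k => Units.ext <| by
    rw [mem_iInter] at hx
    rw [(L k).transUnit_val (hx k) (hx k), (L k).coord_frame (hx k)]
    rfl
  T_mul i j l x hi hj hl := funext fun k => Units.ext <| by
    rw [mem_iInter] at hi hj hl
    change ((L k).transUnit i j x : ℂ) * ((L k).transUnit j l x : ℂ) = _
    rw [(L k).transUnit_val (hi k) (hj k), (L k).transUnit_val (hj k) (hl k),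
      (L k).transUnit_val (hi k) (hl k), (L k).trans_mul (hj k) l i]
  holomorphic i j x hi hj := Torus.contMDiffAt_iff_apply.2 fun k => by
    rw [mem_iInter] at hi hj
    have h := ((L k).frames.isOpen_U i).inter ((L k).frames.isOpen_U j)
    refine (((L k).frames.holomorphic i j).contMDiffAt
      (h.mem_nhds ⟨hi k, hj k⟩)).congr_of_eventuallyEq ?_
    filter_upwards [h.mem_nhds ⟨hi k, hj k⟩] with y hy
    exact (L k).transUnit_val hy.1 hy.2

end TorusCocycle

/-- Every homomorphism from the character group to the Picard group is a character map. -/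
theorem PrincipalBundle.exists_charMap_eq {p : ℕ} {E X : Type u} [NormedAddCommGroup E]
    [NormedSpace ℂ E] [TopologicalSpace X] [ChartedSpace E X] [IsManifold 𝓘(ℂ, E) ω X]
    (lam : CharGroup p →* Pic E X) : ∃ P : PrincipalBundle p E X, P.charMap = lam := by
  choose L hL using fun k => Quotient.exists_rep (lam (coordChar k))
  refine ⟨(TorusCocycle.ofLineBundles L).bundle, charGroup_hom_ext fun k => ?_⟩
  rw [← hL]
  refine Quotient.sound (TorusCocycle.assoc_bundle_isom _ _ _ (fun i => iInter_subset _ k) ?_)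
  intro i j x hi hj
  rw [coordChar_apply]
  exact ((L k).transUnit_val (mem_iInter.1 hi k) (mem_iInter.1 hj k)).symm

open Module

/-! ### Jacobian determinants and the canonical bundle -/

section BlockDeterminant

/-- This is the shape of the Jacobian of `(z, t) ↦ (z', t T(z))`. In a product basis the matrix is
block triangular, so the term `S` from differentiating `T` does not contribute. -/
theorem det_blockTriangular {E F : Type*} [AddCommGroup E] [Module ℂ E] [FiniteDimensional ℂ E]
    [AddCommGroup F] [Module ℂ F] [FiniteDimensional ℂ F]
    (R : E →ₗ[ℂ] E) (S : E →ₗ[ℂ] F) (D : F →ₗ[ℂ] F) :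
    LinearMap.det ((R ∘ₗ LinearMap.fst ℂ E F).prod
      (S ∘ₗ LinearMap.fst ℂ E F + D ∘ₗ LinearMap.snd ℂ E F)) =
      LinearMap.det R * LinearMap.det D := by
  classical
  let b := finBasis ℂ E
  let b' := finBasis ℂ F
  have h : LinearMap.toMatrix (b.prod b') (b.prod b') ((R ∘ₗ LinearMap.fst ℂ E F).prod
      (S ∘ₗ LinearMap.fst ℂ E F + D ∘ₗ LinearMap.snd ℂ E F)) =
      Matrix.fromBlocks (LinearMap.toMatrix b b R) 0 (LinearMap.toMatrix b b' S)
        (LinearMap.toMatrix b' b' D) := by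
    ext i j
    rcases i with i | i <;> rcases j with j | j <;> simp [LinearMap.toMatrix_apply]
  rw [← LinearMap.det_toMatrix (b.prod b'), h, Matrix.det_fromBlocks_zero₁₂, LinearMap.det_toMatrix,
    LinearMap.det_toMatrix]

theorem det_mulLeft_pi {p : ℕ} (t : Fin p → ℂ) :
    LinearMap.det (LinearMap.mulLeft ℂ t) = ∏ k, t k := by
  have h : LinearMap.mulLeft ℂ t =
      LinearMap.pi fun k => (LinearMap.mulLeft ℂ (t k)).comp (LinearMap.proj k) := by
    ext; simp
  rw [h, LinearMap.det_pi]
  simp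

end BlockDeterminant

section ChartDerivatives

theorem hasMFDerivAt_prodMk_vector {F F' F'' N : Type*} [NormedAddCommGroup F] [NormedSpace ℂ F]
    [NormedAddCommGroup F'] [NormedSpace ℂ F'] [NormedAddCommGroup F''] [NormedSpace ℂ F'']
    [TopologicalSpace N] [ChartedSpace F N] {f : N → F'} {g : N → F''} {m : N}
    {f' : TangentSpace 𝓘(ℂ, F) m →L[ℂ] F'} {g' : TangentSpace 𝓘(ℂ, F) m →L[ℂ] F''}
    (hf : HasMFDerivAt 𝓘(ℂ, F) 𝓘(ℂ, F') f m f') (hg : HasMFDerivAt 𝓘(ℂ, F) 𝓘(ℂ, F'') g m g') :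
    HasMFDerivAt 𝓘(ℂ, F) 𝓘(ℂ, F' × F'') (fun y => (f y, g y)) m (f'.prod g') :=
  ⟨hf.1.prodMk hg.1, hf.2.prodMk hg.2⟩

variable {E X : Type u} [NormedAddCommGroup E] [NormedSpace ℂ E]
  [TopologicalSpace X] [ChartedSpace E X] [IsManifold 𝓘(ℂ, E) ω X]

/-- The derivative at `x` of the chart of `X` near `i`. -/
def chartDeriv (i x : X) : E →ₗ[ℂ] E :=
  (mfderiv 𝓘(ℂ, E) 𝓘(ℂ, E) (extChartAt 𝓘(ℂ, E) i) x).toLinearMap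

theorem chartDeriv_eq {i x : X} (hx : x ∈ (chartAt E i).source) :
    (chartDeriv i x : E →ₗ[ℂ] E) =
      (trivializationAt E (TangentSpace 𝓘(ℂ, E)) i).linearMapAt ℂ x := by
  have h := TangentBundle.continuousLinearMapAt_trivializationAt (I := 𝓘(ℂ, E)) hx
  exact (congrArg (fun f => f.toLinearMap) h).symm

/-- The inverse of the derivative at `x` of the chart of `X` near `i`. -/
def chartDerivInv (i x : X) : E →ₗ[ℂ] E :=
  (trivializationAt E (TangentSpace 𝓘(ℂ, E)) i).symmₗ ℂ x

theorem chartDerivInv_chartDeriv {i x : X} (hx : x ∈ (chartAt E i).source) (v : E) :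
    chartDerivInv i x (chartDeriv i x v) = v := by
  rw [chartDeriv_eq hx]
  exact (trivializationAt E (TangentSpace 𝓘(ℂ, E)) i).symmₗ_linearMapAt (R := ℂ) hx v

variable [FiniteDimensional ℂ E]

/-- The coordinate near `j` evaluates a form on the coordinate vectors of the chart `w_j`; on the
frame `dw_i` this gives the Jacobian determinant of `w_i` with respect to `w_j`. -/
theorem canonicalBundle_trans {i j x : X} (hi : x ∈ (chartAt E i).source)
    (hj : x ∈ (chartAt E j).source) :
    (canonicalBundle E X).coord j x ((canonicalBundle E X).frame i x) =
      LinearMap.det ((chartDeriv i x : E →ₗ[ℂ] E) ∘ₗ chartDerivInv j x) := by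
  have h := (finBasis ℂ E).det_comp ((chartDeriv i x : E →ₗ[ℂ] E) ∘ₗ chartDerivInv j x)
    (finBasis ℂ E)
  rw [Basis.det_self, mul_one] at h
  rw [← h, canonicalBundle, LineFrames.toLineBundle_trans _ hi hj]
  refine congrArg (finBasis ℂ E).det (funext fun k => ?_)
  exact (LinearMap.congr_fun (chartDeriv_eq hi) (chartDerivInv j x (finBasis ℂ E k))).symm

end ChartDerivatives

/-! ### Local coordinates and volume forms on the total space -/

namespace PrincipalBundle

variable {p : ℕ} {E X : Type u} [NormedAddCommGroup E] [NormedSpace ℂ E]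
  [TopologicalSpace X] [ChartedSpace E X] (P : PrincipalBundle p E X)

/-- The open set over which both the chart of `X` and the trivialization of `P` near `i` live. -/
def dom (i : X) : Set X := (P.triv i).baseSet ∩ (chartAt E i).source

theorem mem_dom (i : X) : i ∈ P.dom i := ⟨P.mem_triv i, mem_chart_source E i⟩

theorem isOpen_dom (i : X) : IsOpen (P.dom i) :=
  (P.triv i).open_baseSet.inter (chartAt E i).open_source

theorem preimage_dom_mem_nhds {i : X} {m : P.M} (hm : P.proj m ∈ P.dom i) :
    P.proj ⁻¹' P.dom i ∈ 𝓝 m :=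
  P.proj_preimage_mem_nhds ((P.isOpen_dom i).mem_nhds hm)

/-- The local coordinates on `P` formed by the chart of `X` and the trivialization near `i`. -/
def coordMap (i : X) (m : P.M) : E × (Fin p → ℂ) :=
  (extChartAt 𝓘(ℂ, E) i (P.proj m), (P.fib i m).val)

/-- The derivative of the local coordinates. -/
def coordDeriv (i : X) (m : P.M) : (E × (Fin p → ℂ)) →ₗ[ℂ] E × (Fin p → ℂ) :=
  (mfderiv 𝓘(ℂ, E × (Fin p → ℂ)) 𝓘(ℂ, E × (Fin p → ℂ)) (P.coordMap i) m).toLinearMap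

/-- The derivative of the projection. -/
def projDeriv (m : P.M) : (E × (Fin p → ℂ)) →ₗ[ℂ] E :=
  (mfderiv 𝓘(ℂ, E × (Fin p → ℂ)) 𝓘(ℂ, E) P.proj m).toLinearMap

/-- The derivative of the fibre coordinate. -/
def fibDeriv (i : X) (m : P.M) : (E × (Fin p → ℂ)) →ₗ[ℂ] (Fin p → ℂ) :=
  (mfderiv 𝓘(ℂ, E × (Fin p → ℂ)) 𝓘(ℂ, Fin p → ℂ) (fun m => (P.fib i m).val) m).toLinearMap

theorem contMDiffAt_fib_val {i : X} {m : P.M} (hm : P.proj m ∈ (P.triv i).baseSet) :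
    ContMDiffAt 𝓘(ℂ, E × (Fin p → ℂ)) 𝓘(ℂ, Fin p → ℂ) ω (fun m => (P.fib i m).val) m :=
  Torus.contMDiffAt_iff.1 (P.contMDiffAt_fib hm)

/-- The product rule for `t_j = t_i · (T_ij ∘ proj)`. The term `S`, equal to `t_i dT_ij`, is left
unspecified since it factors through the base and drops out of the determinant. -/
theorem fibDeriv_trans {i j : X} {m : P.M} (hi : P.proj m ∈ P.dom i) (hj : P.proj m ∈ P.dom j) :
    ∃ S : E →ₗ[ℂ] (Fin p → ℂ), ∀ v,
      P.fibDeriv j m v = S (P.projDeriv m v) + (P.trans i j (P.proj m)).val * P.fibDeriv i m v := by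
  have h1 : HasMFDerivAt 𝓘(ℂ, E × (Fin p → ℂ)) 𝓘(ℂ, E) P.proj m _ :=
    (P.contMDiff_proj.mdifferentiable (by simp) m).hasMFDerivAt
  have h2 := ((Torus.contMDiffAt_iff.1 (P.contMDiffAt_trans hi.1 hj.1)).mdifferentiableAt
    (by simp)).hasMFDerivAt
  have h3 := ((P.contMDiffAt_fib_val hi.1).mdifferentiableAt (by simp)).hasMFDerivAt
  have h4 := h3.mul (h2.comp m h1)
  have h5 := h4.congr_of_eventuallyEq (f₁ := fun m => (P.fib j m).val) (by
    filter_upwards [P.preimage_dom_mem_nhds hi, P.preimage_dom_mem_nhds hj] with y yi yj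
    change (P.fib j y).val = (P.fib i y).val * (P.trans i j (P.proj y)).val
    rw [P.fib_eq_mul_trans yi.1 yj.1]
    rfl)
  refine ⟨LinearMap.mulLeft ℂ (P.fib i m).val ∘ₗ
    (mfderiv 𝓘(ℂ, E) 𝓘(ℂ, Fin p → ℂ) (fun x => (P.trans i j x).val) (P.proj m)).toLinearMap,
    fun v => ?_⟩
  exact congrArg (fun f => f v) h5.mfderiv

variable [IsManifold 𝓘(ℂ, E) ω X]

theorem contMDiffAt_coordMap {i : X} {m : P.M} (hm : P.proj m ∈ P.dom i) :
    ContMDiffAt 𝓘(ℂ, E × (Fin p → ℂ)) 𝓘(ℂ, E × (Fin p → ℂ)) ω (P.coordMap i) m :=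
  ((contMDiffAt_extChartAt' hm.2).comp m P.contMDiff_proj.contMDiffAt).prodMk_space
    (P.contMDiffAt_fib_val hm.1)

theorem coordDeriv_apply {i : X} {m : P.M} (hm : P.proj m ∈ P.dom i) (v : E × (Fin p → ℂ)) :
    P.coordDeriv i m v = (chartDeriv i (P.proj m) (P.projDeriv m v), P.fibDeriv i m v) := by
  have h1 : HasMFDerivAt 𝓘(ℂ, E × (Fin p → ℂ)) 𝓘(ℂ, E) P.proj m _ :=
    (P.contMDiff_proj.mdifferentiable (by simp) m).hasMFDerivAt
  have h2 : HasMFDerivAt 𝓘(ℂ, E) 𝓘(ℂ, E) (extChartAt 𝓘(ℂ, E) i) (P.proj m) _ :=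
    ((contMDiffAt_extChartAt' (n := ω) hm.2).mdifferentiableAt (by simp)).hasMFDerivAt
  have h3 := ((P.contMDiffAt_fib_val hm.1).mdifferentiableAt (by simp)).hasMFDerivAt
  have h4 := (hasMFDerivAt_prodMk_vector (h2.comp m h1) h3).mfderiv
  have h5 := congrArg (fun f => f v) h4
  exact h5

end PrincipalBundle

theorem canonicalBundle_coord {V Y : Type u} [NormedAddCommGroup V] [NormedSpace ℂ V]
    [FiniteDimensional ℂ V] [TopologicalSpace Y] [ChartedSpace V Y] [IsManifold 𝓘(ℂ, V) ω Y]
    {i y : Y} (hy : y ∈ (chartAt V i).source) (η : TopForms V Y y) :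
    (canonicalBundle V Y).coord i y η = η fun k => chartDerivInv (E := V) i y (finBasis ℂ V k) :=
  (canonicalBundle V Y).coord_apply hy η

/-- The vectors `chartDerivInv y z v` form a coordinate vector field near `y`, so the expression is
the derivative of `f` in tangent coordinates applied to a constant vector. No regularity is lost, as
`ω + 1 = ω`. -/
theorem contMDiffAt_mfderiv_chartDerivInv {V W Y : Type u} [NormedAddCommGroup V] [NormedSpace ℂ V]
    [NormedAddCommGroup W] [NormedSpace ℂ W] [TopologicalSpace Y] [ChartedSpace V Y]
    [IsManifold 𝓘(ℂ, V) ω Y] {f : Y → W} {y : Y} (hf : ContMDiffAt 𝓘(ℂ, V) 𝓘(ℂ, W) ω f y) (v : V) :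
    ContMDiffAt 𝓘(ℂ, V) 𝓘(ℂ, W) ω
      (fun z => (mfderiv 𝓘(ℂ, V) 𝓘(ℂ, W) f z (chartDerivInv (E := V) y z v) : W)) y := by
  have h := (ContMDiffAt.mfderiv_const (m := ω) hf (by simp)).clm_apply
    (contMDiffAt_const (c := v))
  refine h.congr_of_eventuallyEq (Filter.Eventually.of_forall fun z => ?_)
  simp only [inTangentCoordinates, ContinuousLinearMap.inCoordinates,
    TangentBundle.continuousLinearMapAt_model_space]
  rfl

namespace PrincipalBundle

variable {p : ℕ} {E X : Type u} [NormedAddCommGroup E] [NormedSpace ℂ E]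
  [TopologicalSpace X] [ChartedSpace E X] (P : PrincipalBundle p E X)

/-- The inverse of the local coordinates near `i`, around fibre coordinate `h`. -/
def coordMapInv (i : X) (h : Torus p) (q : E × (Fin p → ℂ)) : P.M :=
  (P.triv i).toOpenPartialHomeomorph.symm
    ((extChartAt 𝓘(ℂ, E) i).symm q.1, (extChartAt 𝓘(ℂ, Fin p → ℂ) h).symm q.2)

theorem coordMapInv_coordMap {i : X} (h : Torus p) {m : P.M} (hm : P.proj m ∈ P.dom i) :
    P.coordMapInv i h (P.coordMap i m) = m := by
  have h1 : (extChartAt 𝓘(ℂ, E) i).symm (extChartAt 𝓘(ℂ, E) i (P.proj m)) = P.proj m :=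
    (extChartAt 𝓘(ℂ, E) i).left_inv (by rw [extChartAt_source]; exact hm.2)
  -- The torus has only one chart, so the base point `h` is immaterial.
  have h2 : (extChartAt 𝓘(ℂ, Fin p → ℂ) h).symm (P.fib i m).val = P.fib i m :=
    (extChartAt 𝓘(ℂ, Fin p → ℂ) h).left_inv (by rw [extChartAt_source]; exact mem_univ _)
  rw [coordMapInv, coordMap, h1, h2, P.triv_symm_eq hm.1, P.fib_smul_sec hm.1]

/-- The holomorphic volume form on `P` near `i` given by the local coordinates. -/
def coordForm [FiniteDimensional ℂ E] (i : X) (m : P.M) : TopForms (E × (Fin p → ℂ)) P.M m :=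
  ((finBasis ℂ (E × (Fin p → ℂ))).det.compLinearMap (P.coordDeriv i m) :
    (E × (Fin p → ℂ)) [⋀^Fin (finrank ℂ (E × (Fin p → ℂ)))]→ₗ[ℂ] ℂ)

theorem coordForm_apply [FiniteDimensional ℂ E] (i : X) (m : P.M)
    (v : Fin (finrank ℂ (E × (Fin p → ℂ))) → E × (Fin p → ℂ)) :
    P.coordForm i m v = (finBasis ℂ (E × (Fin p → ℂ))).det (P.coordDeriv i m ∘ v) := rfl

variable [IsManifold 𝓘(ℂ, E) ω X]

theorem contMDiffAt_coordMapInv {i : X} {m : P.M} (hm : P.proj m ∈ P.dom i) :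
    ContMDiffAt 𝓘(ℂ, E × (Fin p → ℂ)) 𝓘(ℂ, E × (Fin p → ℂ)) ω (P.coordMapInv i (P.fib i m))
      (P.coordMap i m) := by
  have hs : P.proj m ∈ (extChartAt 𝓘(ℂ, E) i).source := by rw [extChartAt_source]; exact hm.2
  have h1 : ContMDiffAt 𝓘(ℂ, E × (Fin p → ℂ)) 𝓘(ℂ, E) ω
      (fun q : E × (Fin p → ℂ) => (extChartAt 𝓘(ℂ, E) i).symm q.1) (P.coordMap i m) :=
    ContMDiffAt.comp (P.coordMap i m) (I' := 𝓘(ℂ, E))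
      ((contMDiffOn_extChartAt_symm i).contMDiffAt
        ((isOpen_extChartAt_target i).mem_nhds ((extChartAt 𝓘(ℂ, E) i).map_source hs)))
      contDiffAt_fst.contMDiffAt
  have h2 : ContMDiffAt 𝓘(ℂ, E × (Fin p → ℂ)) 𝓘(ℂ, Fin p → ℂ) ω
      (fun q : E × (Fin p → ℂ) => (extChartAt 𝓘(ℂ, Fin p → ℂ) (P.fib i m)).symm q.2)
      (P.coordMap i m) :=
    ContMDiffAt.comp (P.coordMap i m) (I' := 𝓘(ℂ, Fin p → ℂ))
      ((contMDiffOn_extChartAt_symm (P.fib i m)).contMDiffAt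
        ((isOpen_extChartAt_target (P.fib i m)).mem_nhds (mem_extChartAt_target (P.fib i m))))
      contDiffAt_snd.contMDiffAt
  refine ContMDiffAt.comp (P.coordMap i m)
    (g := (P.triv i).toOpenPartialHomeomorph.symm) ?_ (h1.prodMk h2)
  refine P.contMDiffAt_triv_symm ?_ _
  have e : (extChartAt 𝓘(ℂ, E) i).symm (P.coordMap i m).1 = P.proj m :=
    (extChartAt 𝓘(ℂ, E) i).left_inv hs
  rw [e]
  exact hm.1

/-- By the chain rule the derivative of the holomorphic local inverse `coordMapInv` is a left
inverse of `coordDeriv`. -/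
theorem coordDeriv_injective {i : X} {m : P.M} (hm : P.proj m ∈ P.dom i) :
    Function.Injective (P.coordDeriv i m) := by
  have h1 := ((P.contMDiffAt_coordMapInv hm).mdifferentiableAt (by simp)).hasMFDerivAt.comp m
    ((P.contMDiffAt_coordMap hm).mdifferentiableAt (by simp)).hasMFDerivAt
  have h2 := h1.congr_of_eventuallyEq (f₁ := id) (by
    filter_upwards [P.preimage_dom_mem_nhds hm] with y hy
    exact (P.coordMapInv_coordMap _ hy).symm)
  have h3 := h2.mfderiv
  rw [mfderiv_id] at h3
  intro v w hvw
  have e : ∀ v : E × (Fin p → ℂ), v = mfderiv 𝓘(ℂ, E × (Fin p → ℂ)) 𝓘(ℂ, E × (Fin p → ℂ))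
      (P.coordMapInv i (P.fib i m)) (P.coordMap i m) (P.coordDeriv i m v) :=
    fun v => congrArg (fun f => f v) h3
  rw [e v, hvw, ← e w]

theorem coordDeriv_smul (h : Torus p) {i : X} {m : P.M} (hm : P.proj m ∈ P.dom i)
    (v : E × (Fin p → ℂ)) :
    P.coordDeriv i (h • m) (mfderiv 𝓘(ℂ, E × (Fin p → ℂ)) 𝓘(ℂ, E × (Fin p → ℂ))
      (fun m' : P.M => h • m') m v) =
      ((P.coordDeriv i m v).1, h.val * (P.coordDeriv i m v).2) := by
  have hm' : P.proj (h • m) ∈ P.dom i := by rwa [P.proj_smul]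
  have h1 := ((P.contMDiffAt_coordMap hm').mdifferentiableAt (by simp)).hasMFDerivAt.comp m
    ((P.contMDiff_smul h).mdifferentiable (by simp) m).hasMFDerivAt
  have h2 : HasMFDerivAt 𝓘(ℂ, E × (Fin p → ℂ)) 𝓘(ℂ, E × (Fin p → ℂ)) (P.coordMap i) m _ :=
    ((P.contMDiffAt_coordMap hm).mdifferentiableAt (by simp)).hasMFDerivAt
  -- In local coordinates translation by `h` is the restriction of the linear map `(z, t) ↦ (z, h
  -- t)`, which is its own derivative.
  let D : (E × (Fin p → ℂ)) →L[ℂ] (E × (Fin p → ℂ)) :=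
    (ContinuousLinearMap.fst ℂ _ _).prod
      (ContinuousLinearMap.mul ℂ (Fin p → ℂ) h.val ∘L ContinuousLinearMap.snd ℂ _ _)
  have h3 := (D.hasMFDerivAt (x := P.coordMap i m)).comp m h2
  have h4 := h1.congr_of_eventuallyEq (f₁ := D ∘ P.coordMap i) (by
    filter_upwards [P.preimage_dom_mem_nhds hm] with y hy
    change ((P.coordMap i y).1, h.val * (P.coordMap i y).2) = P.coordMap i (h • y)
    rw [coordMap, coordMap, P.proj_smul, P.fib_smul h hy.1]
    rfl)
  have h5 := h4.mfderiv.symm.trans h3.mfderiv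
  exact congrArg (fun f => f v) h5

theorem coordDeriv_trans {i j : X} {m : P.M} (hi : P.proj m ∈ P.dom i) (hj : P.proj m ∈ P.dom j) :
    ∃ S : E →ₗ[ℂ] (Fin p → ℂ), P.coordDeriv j m =
      (((chartDeriv j (P.proj m) ∘ₗ chartDerivInv i (P.proj m)) ∘ₗ LinearMap.fst ℂ E _).prod
      (S ∘ₗ LinearMap.fst ℂ E _ +
        LinearMap.mulLeft ℂ (P.trans i j (P.proj m)).val ∘ₗ LinearMap.snd ℂ E _)) ∘ₗ
      P.coordDeriv i m := by
  obtain ⟨S, hS⟩ := P.fibDeriv_trans hi hj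
  -- The map from `fibDeriv_trans` acts on tangent vectors of `X`; composing with `chartDerivInv`
  -- makes it act on their coordinates in the chart near `i`.
  refine ⟨S ∘ₗ chartDerivInv i (P.proj m), LinearMap.ext fun v => ?_⟩
  rw [P.coordDeriv_apply hj, LinearMap.comp_apply, P.coordDeriv_apply hi]
  refine Prod.ext ?_ ?_
  · simp [chartDerivInv_chartDeriv hi.2]
  · simp [chartDerivInv_chartDeriv hi.2, hS]

variable [FiniteDimensional ℂ E]

theorem coordForm_ne_zero {i : X} {m : P.M} (hm : P.proj m ∈ P.dom i) : P.coordForm i m ≠ 0 := by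
  intro h
  let e := LinearEquiv.ofInjectiveEndo _ (P.coordDeriv_injective hm)
  have h1 := P.coordForm_apply i m (e.symm ∘ finBasis ℂ (E × (Fin p → ℂ)))
  have h2 : P.coordDeriv i m ∘ e.symm ∘ finBasis ℂ (E × (Fin p → ℂ)) = finBasis ℂ _ :=
    funext fun k => e.apply_symm_apply _
  rw [h, h2, Basis.det_self] at h1
  exact zero_ne_one h1

/-- The form `dz ∧ dt` changes by the Jacobian of `(z_i, t_i) ↦ (z_j, t_j)`. Its base block gives
the transition function of `K_X`, its fibre block multiplication by `T_ij` with determinant `∏ₖ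
T_ij,k`. Division by `∏ₖ tₖ` will absorb the latter. -/
theorem coordForm_trans {i j : X} {m : P.M} (hi : P.proj m ∈ P.dom i) (hj : P.proj m ∈ P.dom j) :
    P.coordForm j m = ((canonicalBundle E X).coord i (P.proj m)
      ((canonicalBundle E X).frame j (P.proj m)) *
        ∏ k, (P.trans i j (P.proj m) k : ℂ)) • P.coordForm i m := by
  obtain ⟨S, hS⟩ := P.coordDeriv_trans hi hj
  refine AlternatingMap.ext fun (v : Fin _ → E × (Fin p → ℂ)) => ?_
  refine (P.coordForm_apply j m v).trans ?_
  rw [hS, LinearMap.coe_comp, Function.comp_assoc, Basis.det_comp, det_blockTriangular,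
    det_mulLeft_pi, ← canonicalBundle_trans hj.2 hi.2]
  rfl

theorem coordForm_smul (h : Torus p) {i : X} {m : P.M} (hm : P.proj m ∈ P.dom i) :
    (P.coordForm i (h • m)).compLinearMap
      (mfderiv 𝓘(ℂ, E × (Fin p → ℂ)) 𝓘(ℂ, E × (Fin p → ℂ)) (fun m' : P.M => h • m') m).toLinearMap
      = (∏ k, (h k : ℂ)) • P.coordForm i m := by
  have h1 := det_blockTriangular (LinearMap.id : E →ₗ[ℂ] E) 0 (LinearMap.mulLeft ℂ h.val)
  rw [LinearMap.det_id, one_mul, det_mulLeft_pi] at h1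
  refine AlternatingMap.ext fun v => ?_
  have h2 := (finBasis ℂ (E × (Fin p → ℂ))).det_comp
    (((LinearMap.id : E →ₗ[ℂ] E) ∘ₗ LinearMap.fst ℂ E _).prod
      ((0 : E →ₗ[ℂ] (Fin p → ℂ)) ∘ₗ LinearMap.fst ℂ E _ +
        LinearMap.mulLeft ℂ h.val ∘ₗ LinearMap.snd ℂ E _)) (P.coordDeriv i m ∘ v)
  rw [h1] at h2
  refine Eq.trans ?_ h2
  refine congrArg (finBasis ℂ (E × (Fin p → ℂ))).det (funext fun k => ?_)
  refine (P.coordDeriv_smul h hm (v k)).trans ?_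
  exact Prod.ext rfl (zero_add _).symm

theorem contMDiffAt_coord_coordForm {i : X} {m : P.M} (hm : P.proj m ∈ P.dom i) :
    ContMDiffAt 𝓘(ℂ, E × (Fin p → ℂ)) 𝓘(ℂ, ℂ) ω
      (fun y => (canonicalBundle (E × (Fin p → ℂ)) P.M).coord m y (P.coordForm i y)) m := by
  have h1 : ContMDiffAt 𝓘(ℂ, E × (Fin p → ℂ))
      𝓘(ℂ, Fin (finrank ℂ (E × (Fin p → ℂ))) → E × (Fin p → ℂ)) ω
      (fun y k => P.coordDeriv i y (chartDerivInv m y (finBasis ℂ (E × (Fin p → ℂ)) k))) m :=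
    contMDiffAt_pi_space.2 fun k =>
      contMDiffAt_mfderiv_chartDerivInv (P.contMDiffAt_coordMap hm) _
  refine ((contDiff_det (E × (Fin p → ℂ))).contMDiff.contMDiffAt.comp m h1).congr_of_eventuallyEq ?_
  filter_upwards [chart_source_mem_nhds (E × (Fin p → ℂ)) m] with y hy
  exact canonicalBundle_coord hy _

end PrincipalBundle

/-! ### Construction of the CY form -/

namespace PrincipalBundle

variable {p : ℕ} {E X : Type u} [NormedAddCommGroup E] [NormedSpace ℂ E] [FiniteDimensional ℂ E]
  [TopologicalSpace X] [ChartedSpace E X] [IsManifold 𝓘(ℂ, E) ω X] (P : PrincipalBundle p E X)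

/-- A principal bundle is CY if the canonical bundle of the base is associated to it. -/
theorem isCY_of_assoc_isom {χ : CharGroup p} (h : (P.assoc χ).Isom (canonicalBundle E X)) :
    P.IsCY := by
  obtain ⟨c, hc, h0, hcc⟩ := h.exists_cocycle
  have hne : ∀ g : Torus p, ∏ k, (g k : ℂ) ≠ 0 :=
    fun g => Finset.prod_ne_zero_iff.2 fun k _ => Units.ne_zero _
  -- Here `c i * χ(t_i)` is the coefficient of the image of `[m, 1]` in `K_X`, and the denominator
  -- turns `dt` into `dt₁/t₁ ∧ ⋯ ∧ dt_p/t_p`.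
  let a : X → P.M → ℂ := fun i m => c i (P.proj m) * χ.1 (P.fib i m) / ∏ k, (P.fib i m k : ℂ)
  let η : ∀ m : P.M, TopForms (E × (Fin p → ℂ)) P.M m :=
    fun m => a (P.proj m) m • P.coordForm (P.proj m) m
  -- The form is defined with an index moving with `m`. Equality with the expression for any fixed
  -- `i` is what yields holomorphy and equivariance.
  have hη : ∀ i m, P.proj m ∈ P.dom i → η m = a i m • P.coordForm i m := by
    intro i m hi
    have hx := P.mem_dom (P.proj m)
    have e1 := hcc i (P.proj m) (P.proj m) hi.1 hi.2 hx.1 hx.2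
    rw [P.assoc_trans χ hi.1 hx.1] at e1
    have e2 := (canonicalBundle E X).trans_mul_trans (i := i) (j := P.proj m) (x := P.proj m)
      hi.2 hx.2
    have e3 : ∏ k, (P.fib (P.proj m) m k : ℂ) =
        (∏ k, (P.fib i m k : ℂ)) * ∏ k, (P.trans i (P.proj m) (P.proj m) k : ℂ) := by
      rw [← Finset.prod_mul_distrib]
      refine Finset.prod_congr rfl fun k _ => ?_
      rw [P.fib_eq_mul_trans hi.1 hx.1]
      rfl
    have e4 : (χ.1 (P.fib (P.proj m) m) : ℂ) =
        χ.1 (P.fib i m) * χ.1 (P.trans i (P.proj m) (P.proj m)) := by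
      rw [P.fib_eq_mul_trans hi.1 hx.1, map_mul, Units.val_mul]
    have n1 := hne (P.fib i m)
    have n2 := hne (P.trans i (P.proj m) (P.proj m))
    simp only [η, a]
    rw [P.coordForm_trans hi hx, smul_smul, e3, e4]
    congr 1
    field_simp
    change _ = (χ.1 (P.trans i (P.proj m) (P.proj m)) : ℂ) * _ at e1
    -- With `x = P.proj m`, what remains is `c x x * χ(T) * κ = c i x`, for `κ` the `K_X`-transition
    -- from `x` to `i`. Multiplying `e1` by `κ` and cancelling by `e2` gives this.
    linear_combination -((canonicalBundle E X).coord i (P.proj m)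
      ((canonicalBundle E X).frame (P.proj m) (P.proj m))) * e1 + c i (P.proj m) * e2
  have ha : ∀ m, ContMDiffAt 𝓘(ℂ, E × (Fin p → ℂ)) 𝓘(ℂ, ℂ) ω (a (P.proj m)) m := by
    intro m
    have hf := P.contMDiffAt_fib (P.mem_triv (P.proj m))
    refine (((hc (P.proj m)).comp m P.contMDiff_proj.contMDiffAt).mul
      ((contMDiff_char χ).contMDiffAt.comp m hf)).div₀ ?_ (hne _)
    exact contMDiffAt_finsetProd fun k _ => Torus.contMDiffAt_iff_apply.1 hf k
  have ha0 : ∀ m, a (P.proj m) m ≠ 0 := fun m => div_ne_zero (mul_ne_zero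
    (h0 _ _ (P.mem_dom _).1 (P.mem_dom _).2) (Units.ne_zero _)) (hne _)
  refine ⟨η, χ, fun m => ?_, fun m => ?_, fun h m => ?_⟩
  · refine (HolLineBundle.contMDiffAt_iff_coord (HolLineBundle.mem_U _ m) contMDiffAt_id).2 ?_
    have hm := P.mem_dom (P.proj m)
    refine ((ha m).mul (P.contMDiffAt_coord_coordForm hm)).congr_of_eventuallyEq ?_
    filter_upwards [P.preimage_dom_mem_nhds hm] with y hy
    simp only [hη _ y hy]
    exact map_smul _ _ _
  · exact smul_ne_zero (ha0 m) (P.coordForm_ne_zero (P.mem_dom _))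
  · have hm := P.mem_dom (P.proj m)
    have e1 : η (h • m) = a (P.proj m) (h • m) • P.coordForm (P.proj m) (h • m) :=
      hη _ _ (by rwa [P.proj_smul])
    -- The factor `∏ₖ hₖ` by which `dz ∧ dt` scales cancels against the denominator of `a`, so only
    -- the weight `χ(h)` survives.
    have e2 : a (P.proj m) (h • m) * ∏ k, (h k : ℂ) = χ.1 h * a (P.proj m) m := by
      have e3 : ∏ k, ((h * P.fib (P.proj m) m) k : ℂ) =
          (∏ k, (h k : ℂ)) * ∏ k, (P.fib (P.proj m) m k : ℂ) := by
        rw [← Finset.prod_mul_distrib]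
        rfl
      have n1 := hne h
      have n2 := hne (P.fib (P.proj m) m)
      simp only [a]
      rw [P.proj_smul, P.fib_smul h hm.1, map_mul, Units.val_mul, e3]
      field_simp
    rw [e1]
    refine Eq.trans (b := a (P.proj m) (h • m) • ((∏ k, (h k : ℂ)) • P.coordForm (P.proj m) m)) ?_ ?_
    · rw [← P.coordForm_smul h hm]
      rfl
    · rw [smul_smul, e2, mul_smul]

end PrincipalBundle

end CYBundle

end

theorem mainTheorem4 {E X : Type u} [NormedAddCommGroup E] [NormedSpace ℂ E]
    [FiniteDimensional ℂ E] [TopologicalSpace X] [ChartedSpace E X] [IsManifold 𝓘(ℂ, E) ω X]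
    (p : ℕ) (lam : CharGroup p →* Pic E X) (hlam : (canonicalBundle E X).toPic ∈ lam.range) :
    ∃ M : PrincipalBundle p E X, M.IsCY ∧ M.charMap = lam ∧
      ∀ N : PrincipalBundle p E X, N.IsCY → N.charMap = lam → N.Isom M := by
  obtain ⟨M, rfl⟩ := PrincipalBundle.exists_charMap_eq lam
  obtain ⟨χ, hχ⟩ := hlam
  exact ⟨M, M.isCY_of_assoc_isom (Quotient.exact hχ), rfl,
    fun N _ hN => PrincipalBundle.isom_of_charMap_eq hN⟩
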